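/- Let $p$ be a prime and let $R$ be a totally ramified extension of $\mathbb{Z}_p$ of degree $n\ge 1$, i.e. a discrete valuation ring of characteristic zero that is a finitely generated $\mathbb{Z}_p$-module of rank $n$ and whose residue field has degree $f=1$ over $\mathbb{F}_p$; $R$ carries its natural (maximal-adic) topology. Let $H(R)$ be the Heisenberg group of upper unitriangular $3\times 3$ matrices over $R$. For a profinite group $G$ with only finitely many open normal subgroups of each finite index, let $\zeta^{\triangleleft}_G(s)=\sum_{m\ge 1}a^{\triangleleft}_m(G)m^{-s}$, where $a^{\triangleleft}_m(G)$ is the number of open normal subgroups of index $m$ in $G$, and write $\zeta_{\mathbb{Z}_p^{2n}}(s)$ for this series for $G=\mathbb{Z}_p^{2n}$. For $N\ge 0$ let $S_N$ be the symmetric group on $\{1,\dots,N\}$ with Coxeter generators $s_i=(i\ \,i+1)$, $1\le i\le N-1$, and Coxeter length $\ell$. Let $\mathrm{Des}(w)=\{i \mid 1\le i\le N-1,\ \ell(ws_i)<\ell(w)\}$, and for $I\subseteq\{1,\dots,N-1\}$ let $\ell^{I}(w)$ be the length of the shortest element of the coset $wW_I$, where $W_I=\langle s_i \mid i\in I\rangle$.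 Write $[k]=\{1,\dots,k\}$, with $[k]=\varnothing$ for $k\le 0$. Put $x_i=p^{(2n+i)(n-i)-(3n-i)s}$ for $i\in[n-1]$. Then $a^{\triangleleft}_m(H(R))$ is finite for every $m\ge 1$, and for all complex $s$ with $\mathrm{Re}(s)>2n-1$ the series $\zeta^{\triangleleft}_{H(R)}(s)$ and $\zeta_{\mathbb{Z}_p^{2n}}(s)$ converge absolutely and $$\zeta^{\triangleleft}_{H(R)}(s)=\zeta_{\mathbb{Z}_p^{2n}}(s)\,\frac{\sum_{w\in S_{n-1}}p^{-\ell(w)+2\ell^{[n-3]}(w)s}\prod_{j\in\mathrm{Des}(w)}x_{j+1}}{(1-p^{2n-3s})\prod_{i=1}^{n-1}(1-x_i)}.$$ -/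

import Mathlib

/-- The set of open normal subgroups of index `m` in a topological group `G`. -/
def openNormalSubgroups (G : Type*) [Group G] [TopologicalSpace G] (m : ℕ) :
    Set (Subgroup G) :=
  {N | N.Normal ∧ IsOpen (N : Set G) ∧ N.index = m}

/-- The number of open normal subgroups of index `m`, as a complex number. -/
noncomputable def normalCount (G : Type*) [Group G] [TopologicalSpace G] (m : ℕ) : ℂ :=
  ((openNormalSubgroups G m).ncard : ℂ)

/-- The normal zeta function `∑_{m ≥ 1} a_m m ^ (-s)` of a topological group `G`, where `a_m` is
the number of open normal subgroups of index `m`. -/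
noncomputable def normalZeta (G : Type*) [Group G] [TopologicalSpace G] (s : ℂ) : ℂ :=
  LSeries (normalCount G) s

/-- The Heisenberg group `H(R)`: upper unitriangular `3 × 3` matrices over `R`. It carries the
subspace topology from `3 × 3` matrices when `R` is a topological ring. -/
def heisenbergGroup (R : Type*) [CommRing R] :
    Subgroup (Matrix.SpecialLinearGroup (Fin 3) R) where
  carrier := {M | (∀ i, M i i = 1) ∧ ∀ i j, j < i → M i j = 0}
  one_mem' := by
    refine ⟨fun i => by simp, fun i j h => ?_⟩
    simp [Matrix.one_apply_ne h.ne']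
  mul_mem' := by
    rintro A B ⟨hA, hA'⟩ ⟨hB, hB'⟩
    refine ⟨fun i => ?_, fun i j h => ?_⟩
    · fin_cases i <;>
        simp [Matrix.SpecialLinearGroup.coe_mul, Matrix.mul_apply, Fin.sum_univ_three, hA, hB,
          hA' 1 0, hA' 2 0, hA' 2 1, hB' 1 0, hB' 2 0, hB' 2 1]
    · fin_cases i <;> fin_cases j <;>
        simp [Matrix.SpecialLinearGroup.coe_mul, Matrix.mul_apply, Fin.sum_univ_three, hA, hB,
          hA' 1 0, hA' 2 0, hA' 2 1, hB' 1 0, hB' 2 0, hB' 2 1] at h ⊢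
  inv_mem' := by
    rintro A ⟨hA, hA'⟩
    refine ⟨fun i => ?_, fun i j h => ?_⟩
    · fin_cases i <;>
        simp [Matrix.SpecialLinearGroup.coe_inv, Matrix.adjugate_fin_three, hA,
          hA' 1 0, hA' 2 0, hA' 2 1]
    · fin_cases i <;> fin_cases j <;>
        simp [Matrix.SpecialLinearGroup.coe_inv, Matrix.adjugate_fin_three, hA,
          hA' 1 0, hA' 2 0, hA' 2 1] at h ⊢

/-- The Coxeter generator `s_i = (i i+1)` of the symmetric group on `N` letters, `1 ≤ i ≤ N - 1`.
The letters `1, …, N` are the elements `0, …, N - 1` of `Fin N`; for other values of `i` (never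
used) the value is `1`. -/
def coxeterGen (N i : ℕ) : Equiv.Perm (Fin N) :=
  if h : 1 ≤ i ∧ i < N then Equiv.swap ⟨i - 1, by omega⟩ ⟨i, h.2⟩ else 1

/-- The Coxeter length: the length of a shortest word in `s_1, …, s_{N-1}` representing `w`. -/
noncomputable def coxeterLength {N : ℕ} (w : Equiv.Perm (Fin N)) : ℕ :=
  sInf {k | ∃ l : List ℕ, (∀ i ∈ l, i ∈ Finset.Icc 1 (N - 1)) ∧
    (l.map (coxeterGen N)).prod = w ∧ l.length = k}

/-- The parabolic subgroup `W_I` generated by the `s_i` with `i ∈ I`. -/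
def parabolicSubgroup (N : ℕ) (I : Finset ℕ) : Subgroup (Equiv.Perm (Fin N)) :=
  Subgroup.closure (coxeterGen N '' (I : Set ℕ))

/-- The right parabolic length `ℓ^I(w)`: the length of a shortest element of the coset `w W_I`. -/
noncomputable def parabolicLength {N : ℕ} (I : Finset ℕ) (w : Equiv.Perm (Fin N)) : ℕ :=
  sInf {k | ∃ v ∈ parabolicSubgroup N I, coxeterLength (w * v) = k}

open scoped Classical in
/-- The right descent set `{i ∈ {1, …, N - 1} | ℓ(w s_i) < ℓ(w)}`. -/
noncomputable def descentSet {N : ℕ} (w : Equiv.Perm (Fin N)) : Finset ℕ :=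
  {i ∈ Finset.Icc 1 (N - 1) | coxeterLength (w * coxeterGen N i) < coxeterLength w}

/-- The numerical data `x_i = p ^ ((2n + i)(n - i) - (3n - i) s)`. -/
noncomputable def numericalData (p n : ℕ) (s : ℂ) (i : ℕ) : ℂ :=
  (p : ℂ) ^ ((2 * (n : ℂ) + i) * ((n : ℂ) - i) - (3 * (n : ℂ) - i) * s)

/-! A normal subgroup of finite index in `H(R)` meets the centre in a lattice `M` of `R` and has an
image `P` in `R × R`. Commutators with elementary matrices show that every entry of an element of
`P` generates an ideal contained in `M`. Since the largest ideal inside `M` is `π ^ k R`, with `k`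
the conductor of `M`, this says `P = π ^ k L` for a lattice `L`, which is otherwise arbitrary. The
cocycle `x A * y B` then dies modulo `M`, so the subgroup is recovered from `L`, `M` and a
homomorphism `L → R / M`. There are `[R : M] ^ (2n)` of these, and the index is `[R × R : L] * p ^
(2k) * [R : M]`. Hence the zeta function is the product of the zeta function of `ℤ_p ^ (2n)` and a
sum over `M` in the variables `X = p ^ (2n - s)` and `Y = p ^ (-2s)`, recording index and conductor
(`heisenbergGroup.hasSum_index_normal`).

The sum over `M` is organised by value sets. The valuations of the nonzero elements of `M` form a
cofinite set `S` closed under adding `n = v(p)`. As the residue field is `𝔽_p`, the index of `M` is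
`p` to the number of gaps of `S`. Lattices with value set `S` have unique reduced bases, and their
number is `p` to the number of pairs consisting of a generator and a gap above it
(`card_valueSet_eq`). Such an `S` amounts to its minimum `t` and a vector `b` of `n - 1` naturals.
Summing over `t` gives `1 / (1 - X * Y)`.

The sum over `b` is done by stable sorting: `b` corresponds to a permutation `w` and arbitrary
increments `d`, with an additional forced jump at each descent of `w` (`arrangement_bijective`). In
these coordinates the index exponent is linear in the jumps, the counting exponent is linear minus
`ℓ(w)`, and the conductor is linear minus the parabolic length of `w`. Each `w` therefore
contributes a product of geometric series (`hasSum_composition`). -/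

/-! ### Coxeter length, descents and parabolic length through inversions. -/

/-- The set of inversions of a permutation, as pairs of positions. -/
def inversionSet {N : ℕ} (w : Equiv.Perm (Fin N)) : Finset (Fin N × Fin N) :=
  {q | q.1 < q.2 ∧ w q.2 < w q.1}

theorem mem_inversionSet {N : ℕ} {w : Equiv.Perm (Fin N)} {x y : Fin N} :
    (x, y) ∈ inversionSet w ↔ x < y ∧ w y < w x := by
  simp [inversionSet]

theorem swap_adjacent_lt {N : ℕ} {a b x y : Fin N} (hab : (b : ℕ) = a + 1) (hxy : x < y)
    (hne : ¬ (x = a ∧ y = b)) : Equiv.swap a b x < Equiv.swap a b y := by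
  simp only [Equiv.swap_apply_def]
  split_ifs <;> simp only [Fin.lt_def, Fin.ext_iff] at * <;> omega

/-- An adjacent transposition preserves the order of every pair of positions except the swapped one.
So the new inversions are the transported old ones together with `(a, b)`. -/
theorem card_inversionSet_mul_swap {N : ℕ} (w : Equiv.Perm (Fin N)) {a b : Fin N}
    (hab : (b : ℕ) = a + 1) (h : w a < w b) :
    (inversionSet (w * Equiv.swap a b)).card = (inversionSet w).card + 1 := by
  classical
  set s := Equiv.swap a b with hs
  have hss : ∀ x, s (s x) = x := fun x => by simp [hs]
  have hmem : (a, b) ∉ (inversionSet w).map (s.prodCongr s).toEmbedding := by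
    simp only [Finset.mem_map, not_exists, not_and]
    rintro ⟨x, y⟩ hxy heq
    rw [mem_inversionSet] at hxy
    simp only [Equiv.toEmbedding_apply, Equiv.prodCongr_apply, Prod.map_apply, Prod.mk.injEq] at heq
    have hx : x = b := by rw [← hss x, heq.1]; simp [hs]
    have hy : y = a := by rw [← hss y, heq.2]; simp [hs]
    have := hxy.1
    rw [hx, hy, Fin.lt_def] at this
    omega
  rw [← Finset.card_map (s := inversionSet w) (s.prodCongr s).toEmbedding,
    ← Finset.card_insert_of_notMem hmem]
  congr 1
  ext ⟨x, y⟩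
  rw [mem_inversionSet, Finset.mem_insert, Finset.mem_map]
  have key : (∃ q ∈ inversionSet w, (s.prodCongr s).toEmbedding q = (x, y)) ↔
      s x < s y ∧ w (s y) < w (s x) := by
    constructor
    · rintro ⟨⟨x', y'⟩, hq, heq⟩
      simp only [Equiv.toEmbedding_apply, Equiv.prodCongr_apply, Prod.map_apply,
        Prod.mk.injEq] at heq
      rw [← heq.1, ← heq.2, hss, hss]
      exact mem_inversionSet.1 hq
    · intro hq
      exact ⟨(s x, s y), mem_inversionSet.2 hq, by simp [hss]⟩
  rw [key]
  simp only [Equiv.Perm.mul_apply, Prod.mk.injEq]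
  constructor
  · rintro ⟨h1, h2⟩
    by_cases hne : x = a ∧ y = b
    · exact Or.inl hne
    · exact Or.inr ⟨swap_adjacent_lt hab h1 hne, h2⟩
  · rintro (⟨rfl, rfl⟩ | ⟨h1, h2⟩)
    · refine ⟨by rw [Fin.lt_def]; omega, ?_⟩
      simpa [hs] using h
    · refine ⟨?_, h2⟩
      by_cases hne : s x = a ∧ s y = b
      · rw [hne.1, hne.2] at h2
        exact absurd h2 h.not_gt
      · have := swap_adjacent_lt hab h1 hne
        rwa [← hs, hss, hss] at this

theorem card_inversionSet_mul_swap' {N : ℕ} (w : Equiv.Perm (Fin N)) {a b : Fin N}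
    (hab : (b : ℕ) = a + 1) (h : w b < w a) :
    (inversionSet w).card = (inversionSet (w * Equiv.swap a b)).card + 1 := by
  have := card_inversionSet_mul_swap (w * Equiv.swap a b) hab (by simpa using h)
  rwa [mul_assoc, Equiv.swap_mul_self, mul_one] at this

theorem coxeterGen_of_mem {N i : ℕ} (h : 1 ≤ i ∧ i < N) :
    coxeterGen N i = Equiv.swap ⟨i - 1, by omega⟩ ⟨i, h.2⟩ := dif_pos h

theorem card_inversionSet_mul_coxeterGen_lt_iff {N i : ℕ} (w : Equiv.Perm (Fin N))
    (h : 1 ≤ i ∧ i < N) :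
    (inversionSet (w * coxeterGen N i)).card < (inversionSet w).card ↔
      w ⟨i, h.2⟩ < w ⟨i - 1, by omega⟩ := by
  rw [coxeterGen_of_mem h]
  have hab : ((⟨i, h.2⟩ : Fin N) : ℕ) = (⟨i - 1, by omega⟩ : Fin N) + 1 := by simp; omega
  rcases lt_trichotomy (w ⟨i, h.2⟩) (w ⟨i - 1, by omega⟩) with h1 | h1 | h1
  · have := card_inversionSet_mul_swap' w hab h1
    simp only [h1, iff_true]; omega
  · have := congrArg Fin.val (w.injective h1)
    simp at this; omega
  · have := card_inversionSet_mul_swap w hab h1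
    simp only [h1.not_gt, iff_false]; omega

theorem card_inversionSet_mul_coxeterGen_le {N : ℕ} (w : Equiv.Perm (Fin N)) (i : ℕ) :
    (inversionSet (w * coxeterGen N i)).card ≤ (inversionSet w).card + 1 := by
  by_cases h : 1 ≤ i ∧ i < N
  · rw [coxeterGen_of_mem h]
    have hab : ((⟨i, h.2⟩ : Fin N) : ℕ) = (⟨i - 1, by omega⟩ : Fin N) + 1 := by simp; omega
    rcases lt_trichotomy (w ⟨i, h.2⟩) (w ⟨i - 1, by omega⟩) with h1 | h1 | h1
    · have := card_inversionSet_mul_swap' w hab h1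
      omega
    · have := congrArg Fin.val (w.injective h1)
      simp at this; omega
    · exact (card_inversionSet_mul_swap w hab h1).le
  · simp [coxeterGen, dif_neg h]

theorem strictMonoOn_of_adjacent_lt {N K : ℕ} {α : Type*} [Preorder α] {f : Fin N → α}
    (h : ∀ i (hi : 1 ≤ i ∧ i < N), i ≤ K → f ⟨i - 1, by omega⟩ < f ⟨i, hi.2⟩)
    {x y : Fin N} (hxy : x < y) (hy : (y : ℕ) ≤ K) : f x < f y := by
  obtain ⟨x, hx⟩ := x
  obtain ⟨y, hy'⟩ := y
  simp only [Fin.mk_lt_mk] at hxy hy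
  induction y, hxy using Nat.le_induction with
  | base => exact h (x + 1) ⟨by omega, hy'⟩ hy
  | succ y hxy ih =>
    exact (ih (by omega) (by omega)).trans (h (y + 1) ⟨by omega, hy'⟩ hy)

theorem card_inversionSet_prod_le {N : ℕ} (l : List ℕ) :
    (inversionSet (l.map (coxeterGen N)).prod).card ≤ l.length := by
  induction l using List.reverseRecOn with
  | nil =>
    simp only [List.map_nil, List.prod_nil, List.length_nil, Nat.le_zero, Finset.card_eq_zero]
    ext ⟨x, y⟩
    simp only [mem_inversionSet, Equiv.Perm.one_apply, Finset.notMem_empty, iff_false, not_and]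
    exact fun h => h.not_gt
  | append_singleton l i ih =>
    simp only [List.map_append, List.map_cons, List.map_nil, List.prod_append, List.prod_cons,
      List.prod_nil, mul_one, List.length_append, List.length_singleton]
    exact (card_inversionSet_mul_coxeterGen_le _ i).trans (by omega)

/-- Bubble sort: a permutation with an inversion has one at adjacent positions, and undoing it
lowers the inversion count by exactly one. -/
theorem exists_word {N : ℕ} (w : Equiv.Perm (Fin N)) :
    ∃ l : List ℕ, (∀ i ∈ l, i ∈ Finset.Icc 1 (N - 1)) ∧
      (l.map (coxeterGen N)).prod = w ∧ l.length = (inversionSet w).card := by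
  induction hk : (inversionSet w).card generalizing w with
  | zero =>
    refine ⟨[], by simp, ?_, rfl⟩
    rw [List.map_nil, List.prod_nil, eq_comm, ← Equiv.Perm.monotone_iff]
    intro x y hxy
    by_contra hlt
    have hne : x ≠ y := by rintro rfl; exact hlt le_rfl
    have : (x, y) ∈ inversionSet w :=
      mem_inversionSet.2 ⟨lt_of_le_of_ne hxy hne, not_le.1 hlt⟩
    rw [Finset.card_eq_zero.1 hk] at this
    simp at this
  | succ k ih =>
    have : ∃ i, ∃ h : 1 ≤ i ∧ i < N, w ⟨i, h.2⟩ < w ⟨i - 1, by omega⟩ := by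
      by_contra! hcon
      have hmono : ∀ x y : Fin N, x < y → w x < w y := by
        intro x y hxy
        refine strictMonoOn_of_adjacent_lt (K := N) (fun i hi _ => ?_) hxy y.2.le
        refine lt_of_le_of_ne (hcon i hi) (fun heq => ?_)
        have := congrArg Fin.val (w.injective heq)
        simp at this; omega
      have hempty : inversionSet w = ∅ := by
        ext ⟨x, y⟩
        simp only [mem_inversionSet, Finset.notMem_empty, iff_false, not_and]
        exact fun h => (hmono x y h).not_gt
      rw [hempty] at hk
      simp at hk
    obtain ⟨i, hi, hlt⟩ := this
    have hab : ((⟨i, hi.2⟩ : Fin N) : ℕ) = (⟨i - 1, by omega⟩ : Fin N) + 1 := by simp; omega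
    have hcard := card_inversionSet_mul_swap' w hab hlt
    rw [← coxeterGen_of_mem hi] at hcard
    obtain ⟨l, hl, hprod, hlen⟩ := ih (w * coxeterGen N i) (by omega)
    refine ⟨l ++ [i], ?_, ?_, by simp [hlen]⟩
    · intro j hj
      rcases List.mem_append.1 hj with hj | hj
      · exact hl j hj
      · rw [List.mem_singleton.1 hj, Finset.mem_Icc]; omega
    · simp only [List.map_append, List.map_cons, List.map_nil, List.prod_append, List.prod_cons,
        List.prod_nil, mul_one, hprod]
      rw [coxeterGen_of_mem hi, mul_assoc, Equiv.swap_mul_self, mul_one]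

theorem coxeterLength_eq_card_inversionSet {N : ℕ} (w : Equiv.Perm (Fin N)) :
    coxeterLength w = (inversionSet w).card := by
  apply le_antisymm
  · exact Nat.sInf_le (exists_word w)
  · refine le_csInf ⟨_, exists_word w⟩ ?_
    rintro k ⟨l, -, rfl, rfl⟩
    exact card_inversionSet_prod_le l

theorem mem_descentSet {N i : ℕ} (w : Equiv.Perm (Fin N)) :
    i ∈ descentSet w ↔ ∃ h : 1 ≤ i ∧ i < N, w ⟨i, h.2⟩ < w ⟨i - 1, by omega⟩ := by
  classical
  rw [descentSet, Finset.mem_filter, Finset.mem_Icc]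
  constructor
  · rintro ⟨h1, h2⟩
    have h : 1 ≤ i ∧ i < N := by omega
    rw [coxeterLength_eq_card_inversionSet, coxeterLength_eq_card_inversionSet,
      card_inversionSet_mul_coxeterGen_lt_iff w h] at h2
    exact ⟨h, h2⟩
  · rintro ⟨h, h2⟩
    rw [coxeterLength_eq_card_inversionSet, coxeterLength_eq_card_inversionSet,
      card_inversionSet_mul_coxeterGen_lt_iff w h]
    exact ⟨by omega, h2⟩

theorem parabolicSubgroup_apply_last {N : ℕ} {v : Equiv.Perm (Fin (N + 1))}
    (hv : v ∈ parabolicSubgroup (N + 1) (Finset.Icc 1 (N - 1))) : v (Fin.last N) = Fin.last N := by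
  have : parabolicSubgroup (N + 1) (Finset.Icc 1 (N - 1)) ≤
      MulAction.stabilizer (Equiv.Perm (Fin (N + 1))) (Fin.last N) := by
    rw [parabolicSubgroup, Subgroup.closure_le]
    rintro _ ⟨i, hi, rfl⟩
    simp only [Finset.coe_Icc, Set.mem_Icc] at hi
    rw [SetLike.mem_coe, MulAction.mem_stabilizer_iff, Equiv.Perm.smul_def,
      coxeterGen_of_mem (by omega)]
    apply Equiv.swap_apply_of_ne_of_ne <;> rw [Ne, Fin.ext_iff] <;> simp <;> omega
  exact this hv

theorem card_filter_apply_gt_last {N : ℕ} (w : Equiv.Perm (Fin (N + 1))) :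
    (Finset.univ.filter fun x : Fin (N + 1) => w (Fin.last N) < w x).card =
      N - w (Fin.last N) := by
  have : (Finset.univ.filter fun x : Fin (N + 1) => w (Fin.last N) < w x).map w.toEmbedding =
      Finset.Ioi (w (Fin.last N)) := by
    ext x
    simp only [Finset.mem_map, Finset.mem_filter, Finset.mem_univ, true_and,
      Equiv.toEmbedding_apply, Finset.mem_Ioi]
    constructor
    · rintro ⟨y, hy, rfl⟩; exact hy
    · intro hx; exact ⟨w.symm x, by simpa using hx, by simp⟩
  rw [← Finset.card_map w.toEmbedding, this, Fin.card_Ioi]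
  omega

theorem map_filter_subset_inversionSet {N : ℕ} (w : Equiv.Perm (Fin (N + 1))) :
    (Finset.univ.filter fun x : Fin (N + 1) => w (Fin.last N) < w x).map
      ⟨fun x => (x, Fin.last N), fun _ _ h => (Prod.mk.inj h).1⟩ ⊆ inversionSet w := by
  intro q hq
  simp only [Finset.mem_map, Finset.mem_filter, Finset.mem_univ, true_and] at hq
  obtain ⟨x, hx, rfl⟩ := hq
  refine mem_inversionSet.2 ⟨lt_of_le_of_ne (Fin.le_last x) ?_, hx⟩
  rintro rfl
  exact lt_irrefl _ hx

/-- The parabolic subgroup fixes the last position, so `w (Fin.last N)` is constant on the coset. A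
shortest representative increases on the other positions, hence its inversions all involve the last
one and are counted by the larger values. -/
theorem parabolicLength_eq {N : ℕ} (w : Equiv.Perm (Fin (N + 1))) :
    parabolicLength (Finset.Icc 1 (N - 1)) w = N - w (Fin.last N) := by
  classical
  set P := parabolicSubgroup (N + 1) (Finset.Icc 1 (N - 1)) with hP
  set S : Set ℕ := {k | ∃ v ∈ P, coxeterLength (w * v) = k} with hS
  have hne : S.Nonempty := ⟨_, 1, P.one_mem, rfl⟩
  have hpl : parabolicLength (Finset.Icc 1 (N - 1)) w = sInf S := rfl
  rw [hpl]
  obtain ⟨v, hv, hvk⟩ := Nat.sInf_mem hne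
  rw [← hvk, coxeterLength_eq_card_inversionSet]
  have hlast : (w * v) (Fin.last N) = w (Fin.last N) := by
    rw [Equiv.Perm.mul_apply, parabolicSubgroup_apply_last hv]
  rw [← hlast, ← card_filter_apply_gt_last]
  rw [← Finset.card_map (s := Finset.univ.filter _)
    ⟨fun x => (x, Fin.last N), fun _ _ h => (Prod.mk.inj h).1⟩]
  congr 1
  apply Finset.Subset.antisymm _ (map_filter_subset_inversionSet (w * v))
  rintro ⟨x, y⟩ hxy
  rw [mem_inversionSet] at hxy
  simp only [Finset.mem_map, Finset.mem_filter, Finset.mem_univ, true_and]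
  suffices hy : y = Fin.last N by
    subst hy
    exact ⟨x, hxy.2, rfl⟩
  by_contra hy
  have hyN : (y : ℕ) ≤ N - 1 := by
    have := y.2
    have : (y : ℕ) ≠ N := fun h => hy (Fin.ext h)
    omega
  refine hxy.2.not_gt (strictMonoOn_of_adjacent_lt (K := N - 1) (fun i hi hiK => ?_) hxy.1 hyN)
  rcases lt_trichotomy ((w * v) ⟨i, hi.2⟩) ((w * v) ⟨i - 1, by omega⟩) with h1 | h1 | h1
  -- A descent here could be removed by a generator of the parabolic subgroup, contradicting
  -- minimality.
  · exfalso
    rw [← card_inversionSet_mul_coxeterGen_lt_iff (w * v) hi,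
      ← coxeterLength_eq_card_inversionSet, ← coxeterLength_eq_card_inversionSet, hvk] at h1
    have hmem : coxeterLength (w * v * coxeterGen (N + 1) i) ∈ S := by
      refine ⟨v * coxeterGen (N + 1) i, P.mul_mem hv ?_, by rw [mul_assoc]⟩
      exact Subgroup.subset_closure ⟨i, by simp; omega, rfl⟩
    exact absurd (Nat.sInf_le hmem) (not_le.2 h1)
  · have := congrArg Fin.val ((w * v).injective h1)
    simp at this; omega
  · exact h1

/-! ### Lattices in a totally ramified ring and their value sets. -/

open IsDiscreteValuationRing in
/-- `R` is a discrete valuation ring with uniformizer `π`, in which the rational prime `p` has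
valuation `n`, and whose residue field is represented by `0, …, p - 1`. -/
structure IsTotallyRamifiedAt {R : Type*} [CommRing R] [IsDomain R] [IsDiscreteValuationRing R]
    (p n : ℕ) (π : R) : Prop where
  prime : p.Prime
  irreducible : Irreducible π
  pos : 0 < n
  addVal_prime : addVal R (p : R) = n
  exists_digit : ∀ x : R, ∃ c < p, π ∣ x - (c : R)

section Lattices

open IsDiscreteValuationRing

variable {R : Type*} [CommRing R] [IsDomain R] [IsDiscreteValuationRing R] {p n : ℕ} {π : R}

theorem Irreducible.le_addVal_iff (hπ : Irreducible π) {k : ℕ} {x : R} :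
    (k : ℕ∞) ≤ addVal R x ↔ π ^ k ∣ x := by
  rw [← addVal_le_iff_dvd, hπ.addVal_pow]

theorem Irreducible.addVal_eq_of_dvd_sub (hπ : Irreducible π) {k : ℕ} {x y : R}
    (hy : addVal R y = k) (hxy : π ^ (k + 1) ∣ x - y) : addVal R x = k := by
  have h : addVal R y < addVal R (x - y) := by
    rw [hy]
    refine lt_of_lt_of_le ?_ (hπ.le_addVal_iff.2 hxy)
    exact_mod_cast Nat.lt_succ_self k
  rw [← hy, ← AddValuation.map_add_eq_of_lt_left _ h, add_sub_cancel]

namespace IsTotallyRamifiedAt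

variable (h : IsTotallyRamifiedAt p n π)
include h

theorem dvd_prime : π ∣ (p : R) := by
  have := h.irreducible.le_addVal_iff (k := 1) (x := (p : R))
  rw [pow_one] at this
  rw [← this, h.addVal_prime]
  exact_mod_cast h.pos

theorem addVal_intCast_of_not_dvd {z : ℤ} (hz : ¬ (p : ℤ) ∣ z) : addVal R (z : R) = 0 := by
  have hcop : IsCoprime (p : ℤ) z :=
    (Nat.prime_iff_prime_int.1 h.prime).irreducible.coprime_iff_not_dvd.2 hz
  obtain ⟨a, b, hab⟩ := hcop
  by_contra hne
  have h1 : ((1 : ℕ) : ℕ∞) ≤ addVal R (z : R) := by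
    rw [Nat.cast_one]; exact Order.one_le_iff_ne_zero.2 hne
  rw [h.irreducible.le_addVal_iff, pow_one] at h1
  apply h.irreducible.not_isUnit
  apply isUnit_of_dvd_one
  have : (1 : R) = a * p + b * z := by
    have := congrArg (Int.cast (R := R)) hab.symm
    push_cast at this
    exact this
  rw [this]
  exact dvd_add (h.dvd_prime.mul_left _) (h1.mul_left _)

theorem addVal_prime_pow (j : ℕ) : addVal R ((p : R) ^ j) = (n * j : ℕ) := by
  rw [addVal_pow, h.addVal_prime]
  simp [mul_comm]

theorem exists_addVal_intCast {z : ℤ} (hz : z ≠ 0) : ∃ j : ℕ, addVal R (z : R) = (n * j : ℕ) := by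
  have hp := Nat.prime_iff_prime_int.1 h.prime
  obtain ⟨j, u, hu, rfl⟩ := WfDvdMonoid.max_power_factor hz hp.irreducible
  refine ⟨j, ?_⟩
  push_cast
  rw [addVal_mul, h.addVal_intCast_of_not_dvd hu, add_zero]
  exact_mod_cast h.addVal_prime_pow j

/-- Residue degree one enters here: a leading term can be cancelled by an integer multiple of `y`,
so the reduction stays inside any additive group containing `y`. -/
theorem exists_digit_of_addVal_eq {k : ℕ} {x y : R} (hx : π ^ k ∣ x) (hy : addVal R y = k) :
    ∃ c < p, π ^ (k + 1) ∣ x - (c : R) * y := by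
  obtain ⟨x', rfl⟩ := hx
  have hy' := h.irreducible.le_addVal_iff.1 hy.ge
  obtain ⟨y', rfl⟩ := hy'
  have hu : IsUnit y' := by
    by_contra hu
    have : π ∣ y' := by
      rw [← Ideal.mem_span_singleton, ← h.irreducible.maximalIdeal_eq]
      exact hu
    have h2 : π ^ (k + 1) ∣ π ^ k * y' := by rw [pow_succ]; exact mul_dvd_mul_left _ this
    rw [← h.irreducible.le_addVal_iff, hy] at h2
    have : k + 1 ≤ k := by exact_mod_cast h2
    omega
  obtain ⟨u, rfl⟩ := hu
  obtain ⟨c, hc, hdvd⟩ := h.exists_digit (x' * (u⁻¹ : Rˣ))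
  refine ⟨c, hc, ?_⟩
  have : π ^ k * x' - (c : R) * (π ^ k * (u : R)) =
      π ^ k * ((x' * (u⁻¹ : Rˣ) - c) * u) := by
    have hu : ((u⁻¹ : Rˣ) : R) * u = 1 := u.inv_mul
    linear_combination (- π ^ k * x') * hu
  rw [this, pow_succ]
  exact mul_dvd_mul_left _ (hdvd.mul_right _)

end IsTotallyRamifiedAt

/-- The set of valuations of the nonzero elements of an additive subgroup. -/
def valueSet (M : AddSubgroup R) : Set ℕ := {k | ∃ x ∈ M, addVal R x = k}

/-- The element with given digits with respect to the uniformizer `π`, at places in `F`. -/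
def digitSum (π : R) (F : Finset ℕ) (c : F → Fin p) : R := ∑ g : F, ((c g : ℕ) : R) * π ^ (g : ℕ)

theorem pow_dvd_digitSum {R : Type*} [CommRing R] {π : R} {F : Finset ℕ} {k : ℕ}
    (hF : ∀ g ∈ F, k ≤ g) (c : F → Fin p) :
    π ^ k ∣ digitSum π F c :=
  Finset.dvd_sum fun g _ => (pow_dvd_pow _ (hF g g.2)).mul_left _

namespace IsTotallyRamifiedAt

variable (h : IsTotallyRamifiedAt p n π)
include h

theorem addVal_uniformizer_pow (k : ℕ) : addVal R (π ^ k) = k := h.irreducible.addVal_pow k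

/-- The first place where the digits disagree is the valuation of the difference, which would put a
gap into the value set. -/
theorem digitSum_injective {M : AddSubgroup R} {F : Finset ℕ} (hF : ∀ g ∈ F, g ∉ valueSet M)
    {c c' : F → Fin p} (hc : digitSum π F c - digitSum π F c' ∈ M) : c = c' := by
  classical
  by_contra hne
  have hex : ∃ g, ∃ hg : g ∈ F, c ⟨g, hg⟩ ≠ c' ⟨g, hg⟩ := by
    by_contra! hcon
    exact hne (funext fun g => hcon g g.2)
  obtain ⟨g, ⟨hg, hgne⟩, hmin⟩ : ∃ g, (∃ hg : g ∈ F, c ⟨g, hg⟩ ≠ c' ⟨g, hg⟩) ∧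
      ∀ i : F, (i : ℕ) < g → c i = c' i := by
    refine ⟨Nat.find hex, Nat.find_spec hex, fun i hi => ?_⟩
    have := Nat.find_min hex hi
    push Not at this
    exact this i.2
  refine hF g hg ⟨_, hc, ?_⟩
  set z : ℤ := ((c ⟨g, hg⟩ : ℕ) : ℤ) - ((c' ⟨g, hg⟩ : ℕ) : ℤ) with hz
  have hzd : ¬ (p : ℤ) ∣ z := by
    intro hd
    have h1 := (c ⟨g, hg⟩).2
    have h2 := (c' ⟨g, hg⟩).2
    have h3 : z = 0 := Int.eq_zero_of_abs_lt_dvd hd (by rw [abs_lt]; omega)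
    exact hgne (Fin.ext (by omega))
  apply h.irreducible.addVal_eq_of_dvd_sub (y := (z : R) * π ^ g)
  · rw [addVal_mul, h.addVal_intCast_of_not_dvd hzd, zero_add, h.addVal_uniformizer_pow]
  · have : digitSum π F c - digitSum π F c' =
        ∑ i : F, (((c i : ℕ) : R) - ((c' i : ℕ) : R)) * π ^ (i : ℕ) := by
      simp only [digitSum, ← Finset.sum_sub_distrib, sub_mul]
    rw [this, ← Finset.add_sum_erase _ _ (Finset.mem_univ (⟨g, hg⟩ : F))]
    have h2 : (((c ⟨g, hg⟩ : ℕ) : R) - ((c' ⟨g, hg⟩ : ℕ) : R)) = (z : R) := by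
      rw [hz]; push_cast; rfl
    rw [h2, add_sub_cancel_left]
    apply Finset.dvd_sum
    intro i hi
    rcases lt_trichotomy (i : ℕ) g with hlt | heq | hgt
    · rw [hmin i hlt, sub_self, zero_mul]; exact dvd_zero _
    · exact absurd (Subtype.ext heq) (Finset.ne_of_mem_erase hi)
    · exact (pow_dvd_pow _ hgt).mul_left _

/-- Expansion modulo `M`, place by place up to `K`: at a value of `M` the leading term is removed by
an element of `M`, at a gap it is recorded as a digit. -/
theorem exists_sub_sum_mem {M : AddSubgroup R} {K : ℕ} (hK : ∀ x, π ^ K ∣ x → x ∈ M)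
    [DecidablePred (· ∈ valueSet M)]
    {k : ℕ} (hk : k ≤ K) : ∀ x, π ^ k ∣ x → ∃ c : ℕ → ℕ, (∀ g, c g < p) ∧
      x - ∑ g ∈ (Finset.Ico k K).filter (· ∉ valueSet M), (c g : R) * π ^ g ∈ M := by
  induction hk using Nat.decreasingInduction with
  | self =>
    intro x hx
    refine ⟨fun _ => 0, fun _ => h.prime.pos, ?_⟩
    simpa using hK x hx
  | of_succ k hk ih =>
    intro x hx
    by_cases hkS : k ∈ valueSet M
    · obtain ⟨y, hyM, hy⟩ := hkS
      obtain ⟨a, -, ha⟩ := h.exists_digit_of_addVal_eq hx hy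
      obtain ⟨c, hc, hcM⟩ := ih _ ha
      refine ⟨c, hc, ?_⟩
      rw [← Finset.insert_Ico_add_one_left_eq_Ico hk, Finset.filter_insert,
        if_neg (not_not.2 ⟨y, hyM, hy⟩)]
      have := M.add_mem hcM (M.nsmul_mem hyM a)
      rw [nsmul_eq_mul] at this
      convert this using 1
      ring
    · obtain ⟨a, ha, had⟩ := h.exists_digit_of_addVal_eq hx (h.addVal_uniformizer_pow k)
      obtain ⟨c, hc, hcM⟩ := ih _ had
      refine ⟨Function.update c k a, ?_, ?_⟩
      · intro g
        by_cases hg : g = k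
        · subst hg; simpa using ha
        · simpa [hg] using hc g
      · rw [← Finset.insert_Ico_add_one_left_eq_Ico hk, Finset.filter_insert, if_pos hkS,
          Finset.sum_insert (by simp)]
        rw [Finset.sum_congr rfl (g := fun g => (c g : R) * π ^ g)]
        · convert hcM using 1
          simp
          ring
        · intro g hg
          have : g ≠ k := by
            simp only [Finset.mem_filter, Finset.mem_Ico] at hg
            omega
          simp [this]

theorem exists_sub_digitSum_mem {M : AddSubgroup R} (hK : ∃ K, ∀ x, π ^ K ∣ x → x ∈ M)
    {k : ℕ} {F : Finset ℕ} (hF : ∀ g, g ∈ F ↔ k ≤ g ∧ g ∉ valueSet M) {x : R} (hx : π ^ k ∣ x) :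
    ∃ c : F → Fin p, x - digitSum π F c ∈ M := by
  classical
  obtain ⟨K, hK⟩ := hK
  have hK' : ∀ x, π ^ (K + k) ∣ x → x ∈ M :=
    fun x hx => hK x ((pow_dvd_pow _ (by omega)).trans hx)
  obtain ⟨c, hc, hcM⟩ := h.exists_sub_sum_mem hK' (by omega : k ≤ K + k) x hx
  refine ⟨fun g => ⟨c g, hc g⟩, ?_⟩
  convert hcM using 2
  have hFeq : (Finset.Ico k (K + k)).filter (· ∉ valueSet M) = F := by
    ext g
    rw [hF, Finset.mem_filter, Finset.mem_Ico]
    refine ⟨fun hg => ⟨hg.1.1, hg.2⟩, fun hg => ⟨⟨hg.1, ?_⟩, hg.2⟩⟩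
    by_contra hlt
    exact hg.2 ⟨π ^ g, hK' _ (pow_dvd_pow _ (not_lt.1 hlt)), h.addVal_uniformizer_pow g⟩
  rw [hFeq]
  exact Finset.sum_coe_sort F fun g => (c g : R) * π ^ g

theorem forall_mem_iff {M : AddSubgroup R} (hK : ∃ K, ∀ x, π ^ K ∣ x → x ∈ M) (k : ℕ) :
    (∀ x, π ^ k ∣ x → x ∈ M) ↔ ∀ j, k ≤ j → j ∈ valueSet M := by
  constructor
  · intro hM j hj
    exact ⟨π ^ j, hM _ (pow_dvd_pow _ hj), h.addVal_uniformizer_pow j⟩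
  · intro hS x hx
    obtain ⟨c, hc⟩ := h.exists_sub_digitSum_mem hK (F := ∅) (k := k) (x := x)
      (fun g => by simpa using hS g) hx
    simpa [digitSum] using hc

/-- The digit sums supported on the gaps form a transversal of `M`. -/
theorem index_eq {M : AddSubgroup R} (hK : ∃ K, ∀ x, π ^ K ∣ x → x ∈ M) {F : Finset ℕ}
    (hF : ∀ g, g ∈ F ↔ g ∉ valueSet M) : M.index = p ^ F.card := by
  have hbij : Function.Bijective (fun c : F → Fin p =>
      (QuotientAddGroup.mk (digitSum π F c) : R ⧸ M)) := by
    constructor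
    · intro c c' hcc
      refine (h.digitSum_injective (M := M) (fun g hg => (hF g).1 hg) (c := c') (c' := c) ?_).symm
      have := QuotientAddGroup.eq.1 hcc
      rwa [neg_add_eq_sub] at this
    · intro q
      obtain ⟨x, rfl⟩ := QuotientAddGroup.mk_surjective q
      obtain ⟨c, hc⟩ := h.exists_sub_digitSum_mem hK (k := 0) (F := F) (x := x)
        (fun g => by simpa using hF g) (by simp)
      refine ⟨c, QuotientAddGroup.eq.2 ?_⟩
      rwa [neg_add_eq_sub]
  rw [AddSubgroup.index, ← Nat.card_congr (Equiv.ofBijective _ hbij)]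
  simp

/-- A nonzero index annihilates the quotient, so `M` contains the ideal it generates, which is a
power of the maximal ideal because the characteristic is zero. -/
theorem index_ne_zero_iff [CharZero R] {M : AddSubgroup R} :
    M.index ≠ 0 ↔ ∃ K, ∀ x, π ^ K ∣ x → x ∈ M := by
  constructor
  · intro hM
    obtain ⟨j, hj⟩ := h.exists_addVal_intCast (z := M.index) (by exact_mod_cast hM)
    refine ⟨n * j, fun x hx => ?_⟩
    rw [← h.irreducible.le_addVal_iff, ← hj, addVal_le_iff_dvd] at hx
    obtain ⟨y, rfl⟩ := hx
    have := M.nsmul_index_mem y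
    simpa [nsmul_eq_mul] using this
  · rintro ⟨K, hK⟩
    have hfin : {g | g ∉ valueSet M}.Finite := by
      refine (Set.finite_Iio K).subset fun g hg => ?_
      by_contra hlt
      exact hg ⟨π ^ g, hK _ (pow_dvd_pow _ (not_lt.1 hlt)), h.addVal_uniformizer_pow g⟩
    rw [h.index_eq ⟨K, hK⟩ (F := hfin.toFinset) (by simp)]
    exact pow_ne_zero _ h.prime.ne_zero

theorem add_mem_valueSet {M : AddSubgroup R} {k : ℕ} (hk : k ∈ valueSet M) (j : ℕ) :
    k + n * j ∈ valueSet M := by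
  obtain ⟨x, hx, hv⟩ := hk
  refine ⟨(p : R) ^ j * x, ?_, ?_⟩
  · have := M.nsmul_mem hx (p ^ j)
    simpa [nsmul_eq_mul] using this
  · rw [addVal_mul, h.addVal_prime_pow, hv]
    push_cast
    ring

/-- Every valuation occurring in `M` is that of some `p ^ j * e i`, so leading terms are stripped by
elements common to both groups until the remainder is deep enough to lie in `M'`. -/
theorem le_of_forall_mem {ι : Type*} {m : ι → ℕ} {e : ι → R} {M M' : AddSubgroup R}
    (hS : ∀ k ∈ valueSet M, ∃ i j, k = m i + n * j) (he : ∀ i, addVal R (e i) = m i)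
    (heM : ∀ i, e i ∈ M) (heM' : ∀ i, e i ∈ M') (hK : ∃ K, ∀ x, π ^ K ∣ x → x ∈ M') : M ≤ M' := by
  obtain ⟨K, hK⟩ := hK
  suffices ∀ k ≤ K, ∀ x ∈ M, π ^ k ∣ x → x ∈ M' from
    fun x hx => this 0 (Nat.zero_le _) x hx (by simp)
  intro k hk
  induction hk using Nat.decreasingInduction with
  | self => exact fun x _ hx => hK x hx
  | of_succ k hk ih =>
    intro x hxM hx
    by_cases hx' : π ^ (k + 1) ∣ x
    · exact ih x hxM hx'
    · have hv : addVal R x = k := by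
        rw [← h.irreducible.le_addVal_iff] at hx hx'
        refine le_antisymm ?_ hx
        rw [not_le] at hx'
        exact Order.le_of_lt_add_one (by exact_mod_cast hx')
      obtain ⟨i, j, hij⟩ := hS k ⟨x, hxM, hv⟩
      have hy : addVal R ((p : R) ^ j * e i) = k := by
        rw [addVal_mul, h.addVal_prime_pow, he, hij]
        push_cast
        ring
      obtain ⟨c, -, hc⟩ := h.exists_digit_of_addVal_eq hx hy
      have hmem : ∀ L : AddSubgroup R, e i ∈ L → (c : R) * ((p : R) ^ j * e i) ∈ L := by
        intro L hL
        have := L.nsmul_mem hL (c * p ^ j)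
        rw [nsmul_eq_mul] at this
        convert this using 1
        push_cast
        ring
      have := M'.add_mem (ih _ (M.sub_mem hxM (hmem M (heM i))) hc) (hmem M' (heM' i))
      rwa [sub_add_cancel] at this

/-- Nonzero integers have valuation divisible by `n`, so the nonzero terms have valuations in
distinct classes modulo `n` and the smallest one cannot cancel. -/
theorem addVal_sum_intCast_mul {ι : Type*} [Fintype ι] {m : ι → ℕ} {e : ι → R}
    (hm : Function.Injective fun i => m i % n) (he : ∀ i, addVal R (e i) = m i) (z : ι → ℤ)
    (hz : z ≠ 0) : ∃ i j, addVal R (∑ i, (z i : R) * e i) = (m i + n * j : ℕ) := by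
  classical
  have hval : ∀ i, z i ≠ 0 → ∃ j : ℕ, addVal R ((z i : R) * e i) = (m i + n * j : ℕ) := by
    intro i hi
    obtain ⟨j, hj⟩ := h.exists_addVal_intCast hi
    refine ⟨j, ?_⟩
    rw [addVal_mul, hj, he]
    push_cast
    ring
  have hne : (Finset.univ.filter fun i => z i ≠ 0).Nonempty := by
    obtain ⟨i, hi⟩ := Function.ne_iff.1 hz
    exact ⟨i, by simpa using hi⟩
  obtain ⟨i, hi, hmin⟩ := Finset.exists_min_image _ (fun i => addVal R ((z i : R) * e i)) hne
  simp only [Finset.mem_filter, Finset.mem_univ, true_and] at hi hmin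
  obtain ⟨j, hj⟩ := hval i hi
  refine ⟨i, j, ?_⟩
  rw [← Finset.add_sum_erase _ _ (Finset.mem_univ i), AddValuation.map_add_eq_of_lt_left, hj]
  rw [hj]
  apply AddValuation.map_lt_sum
  · exact ENat.natCast_ne_top _
  · intro i' hi'
    by_cases hz' : z i' = 0
    · simp only [hz', Int.cast_zero, zero_mul, AddValuation.map_zero]
      exact ENat.natCast_lt_top _
    · refine lt_of_le_of_ne (hj ▸ hmin i' hz') fun heq => ?_
      obtain ⟨j', hj'⟩ := hval i' hz'
      rw [hj'] at heq
      have heq' : m i + n * j = m i' + n * j' := by exact_mod_cast heq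
      have := congrArg (· % n) heq'
      simp only [Nat.add_mul_mod_self_left] at this
      exact Finset.ne_of_mem_erase hi' (hm this).symm

theorem exists_valueSet_eq {ι : Type*} [Fintype ι] {m : ι → ℕ} {e : ι → R} {S : Set ℕ}
    (hS : ∀ k, k ∈ S ↔ ∃ i j, k = m i + n * j) (hcof : Sᶜ.Finite)
    (hm : Function.Injective fun i => m i % n) (he : ∀ i, addVal R (e i) = m i) :
    ∃ M : AddSubgroup R, (∃ K, ∀ x, π ^ K ∣ x → x ∈ M) ∧ valueSet M = S ∧ ∀ i, e i ∈ M := by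
  obtain ⟨K, hK⟩ : ∃ K, ∀ k, K ≤ k → k ∈ S := by
    obtain ⟨K, hK⟩ := hcof.bddAbove
    refine ⟨K + 1, fun k hk => ?_⟩
    by_contra hkS
    have := hK hkS
    omega
  -- Adding the ideal of `π ^ K` makes the span deep enough to be a lattice; it creates no new
  -- values, since `S` already contains everything from `K` on.
  set M : AddSubgroup R := (Submodule.span ℤ (Set.range e) ⊔
    (Ideal.span {π ^ K}).restrictScalars ℤ).toAddSubgroup with hM
  have hMmem : ∀ x, x ∈ M ↔ ∃ z : ι → ℤ, π ^ K ∣ x - ∑ i, (z i : R) * e i := by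
    intro x
    rw [hM, Submodule.mem_toAddSubgroup, Submodule.mem_sup]
    constructor
    · rintro ⟨y, hy, w, hw, rfl⟩
      obtain ⟨z, rfl⟩ := Submodule.mem_span_range_iff_exists_fun ℤ |>.1 hy
      refine ⟨z, ?_⟩
      simp only [zsmul_eq_mul, add_sub_cancel_left]
      exact Ideal.mem_span_singleton.1 hw
    · rintro ⟨z, hz⟩
      refine ⟨∑ i, (z i : R) * e i, ?_, _, Ideal.mem_span_singleton.2 hz, by ring⟩
      exact (Submodule.mem_span_range_iff_exists_fun ℤ).2 ⟨z, by simp⟩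
  have heM : ∀ i, e i ∈ M := by
    intro i
    exact Submodule.mem_sup_left (Submodule.subset_span ⟨i, rfl⟩)
  refine ⟨M, ⟨K, fun x hx => (hMmem x).2 ⟨0, by simpa using hx⟩⟩, ?_, heM⟩
  ext k
  constructor
  · rintro ⟨x, hx, hv⟩
    rcases le_or_gt K k with hk | hk
    · exact hK k hk
    · obtain ⟨z, hz⟩ := (hMmem x).1 hx
      have hv' : addVal R (∑ i, (z i : R) * e i) = k := by
        refine h.irreducible.addVal_eq_of_dvd_sub hv ?_
        rw [← dvd_neg, neg_sub]
        exact (pow_dvd_pow _ hk).trans hz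
      have hz0 : z ≠ 0 := by
        rintro rfl
        simp at hv'
      obtain ⟨i, j, hij⟩ := h.addVal_sum_intCast_mul hm he z hz0
      rw [hS]
      refine ⟨i, j, ?_⟩
      rw [hv'] at hij
      exact_mod_cast hij
  · intro hk
    obtain ⟨i, j, rfl⟩ := (hS k).1 hk
    exact h.add_mem_valueSet ⟨e i, heM i, he i⟩ j

/-- The lattices with a given value set are parametrised by the digits of their reduced bases. -/
theorem card_valueSet_eq {ι : Type*} [Fintype ι] {m : ι → ℕ} {S : Set ℕ}
    (hS : ∀ k, k ∈ S ↔ ∃ i j, k = m i + n * j) (hcof : Sᶜ.Finite)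
    (hm : Function.Injective fun i => m i % n) {F : ι → Finset ℕ}
    (hF : ∀ i g, g ∈ F i ↔ m i + 1 ≤ g ∧ g ∉ S) :
    Nonempty ({M : AddSubgroup R // (∃ K, ∀ x, π ^ K ∣ x → x ∈ M) ∧ valueSet M = S} ≃
      (∀ i, F i → Fin p)) := by
  have hval : ∀ (c : ∀ i, F i → Fin p) i, addVal R (π ^ m i - digitSum π (F i) (c i)) = m i := by
    intro c i
    apply h.irreducible.addVal_eq_of_dvd_sub (h.addVal_uniformizer_pow (m i))
    rw [sub_sub_cancel_left, dvd_neg]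
    exact pow_dvd_digitSum (fun g hg => ((hF i g).1 hg).1) _
  have hmS : ∀ i, m i ∈ S := fun i => (hS _).2 ⟨i, 0, by simp⟩
  -- Reduced basis: in each generating valuation, an element whose only further digits sit at gaps.
  have hex : ∀ M : {M : AddSubgroup R // (∃ K, ∀ x, π ^ K ∣ x → x ∈ M) ∧ valueSet M = S},
      ∃ c : ∀ i, F i → Fin p, ∀ i, π ^ m i - digitSum π (F i) (c i) ∈ M.1 := by
    rintro ⟨M, hK, rfl⟩
    rw [← Classical.skolem (p := fun i (c : F i → Fin p) => π ^ m i - digitSum π (F i) c ∈ M)]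
    intro i
    obtain ⟨y, hyM, hy⟩ := hmS i
    obtain ⟨a, -, ha⟩ := h.exists_digit_of_addVal_eq (dvd_refl (π ^ m i)) hy
    obtain ⟨c, hc⟩ := h.exists_sub_digitSum_mem hK (hF i) ha
    refine ⟨c, ?_⟩
    have := M.add_mem hc (M.nsmul_mem hyM a)
    rw [nsmul_eq_mul] at this
    convert this using 1
    ring
  choose f hf using hex
  refine ⟨Equiv.ofBijective f ⟨?_, ?_⟩⟩
  · intro M M' hMM
    have hfM' := hf M'
    rw [← hMM] at hfM'
    apply Subtype.ext
    apply le_antisymm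
    · exact h.le_of_forall_mem (fun k hk => (hS k).1 (M.2.2 ▸ hk)) (hval (f M)) (hf M) hfM' M'.2.1
    · exact h.le_of_forall_mem (fun k hk => (hS k).1 (M'.2.2 ▸ hk)) (hval (f M)) hfM' (hf M) M.2.1
  · intro c
    obtain ⟨M, hK, hMS, heM⟩ := h.exists_valueSet_eq hS hcof hm (hval c)
    refine ⟨⟨M, hK, hMS⟩, ?_⟩
    funext i
    have h1 := hf ⟨M, hK, hMS⟩ i
    refine (h.digitSum_injective (M := M) (fun g hg => hMS ▸ ((hF i g).1 hg).2) ?_).symm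
    have := M.sub_mem h1 (heM i)
    simpa using this

end IsTotallyRamifiedAt

end Lattices

/-! ### Partial sums of increment vectors. -/

section PartialSums

variable {N : ℕ}

theorem sum_Iic_mk_succ (c : Fin N → ℕ) {i : ℕ} (hi : i + 1 < N) :
    ∑ k ∈ Finset.Iic (⟨i + 1, hi⟩ : Fin N), c k =
      ∑ k ∈ Finset.Iic (⟨i, by omega⟩ : Fin N), c k + c ⟨i + 1, hi⟩ := by
  have : Finset.Iic (⟨i + 1, hi⟩ : Fin N) =
      insert ⟨i + 1, hi⟩ (Finset.Iic (⟨i, by omega⟩ : Fin N)) := by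
    ext k
    simp only [Finset.mem_Iic, Finset.mem_insert, Fin.le_def, Fin.ext_iff]
    omega
  rw [this, Finset.sum_insert (by simp [Fin.le_def]), add_comm]

theorem sum_Iic_mk_zero (c : Fin N → ℕ) (h0 : 0 < N) :
    ∑ k ∈ Finset.Iic (⟨0, h0⟩ : Fin N), c k = c ⟨0, h0⟩ := by
  have : Finset.Iic (⟨0, h0⟩ : Fin N) = {⟨0, h0⟩} := by
    ext k
    simp only [Finset.mem_Iic, Finset.mem_singleton, Fin.le_def, Fin.ext_iff]
    omega
  rw [this, Finset.sum_singleton]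

theorem sum_Iic_add_sum_Ioc (c : Fin N → ℕ) {i j : Fin N} (hij : i ≤ j) :
    ∑ k ∈ Finset.Iic i, c k + ∑ k ∈ Finset.Ioc i j, c k = ∑ k ∈ Finset.Iic j, c k := by
  rw [← Finset.sum_union]
  · congr 1
    ext k
    simp only [Finset.mem_union, Finset.mem_Iic, Finset.mem_Ioc, Fin.le_def, Fin.lt_def] at *
    omega
  · rw [Finset.disjoint_left]
    intro k hk
    simp only [Finset.mem_Iic, Finset.mem_Ioc, not_and, Fin.le_def, Fin.lt_def] at *
    omega

theorem sum_Iic_monotone (c : Fin N → ℕ) : Monotone fun j => ∑ k ∈ Finset.Iic j, c k :=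
  fun i j hij => by
    simp only
    rw [← sum_Iic_add_sum_Ioc c hij]
    exact Nat.le_add_right _ _

theorem sum_Iic_injective {c c' : Fin N → ℕ}
    (h : ∀ j, ∑ k ∈ Finset.Iic j, c k = ∑ k ∈ Finset.Iic j, c' k) : c = c' := by
  funext ⟨j, hj⟩
  cases j with
  | zero => simpa only [sum_Iic_mk_zero] using h ⟨0, hj⟩
  | succ j =>
    have h1 := h ⟨j + 1, hj⟩
    rw [sum_Iic_mk_succ, sum_Iic_mk_succ, h ⟨j, by omega⟩] at h1
    omega

theorem exists_sum_Iic_eq {a : Fin N → ℕ} (δ : Fin N → ℕ)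
    (h0 : ∀ h0 : 0 < N, δ ⟨0, h0⟩ = 0)
    (hδ : ∀ i (hi : i + 1 < N), a ⟨i, by omega⟩ + δ ⟨i + 1, hi⟩ ≤ a ⟨i + 1, hi⟩) :
    ∃ d : Fin N → ℕ, ∀ j, ∑ k ∈ Finset.Iic j, (d k + δ k) = a j := by
  -- The natural subtractions are exact because `hδ` bounds each step of `a` below by `δ`.
  refine ⟨fun j => if h : (j : ℕ) = 0 then a j else a j - a ⟨j - 1, by omega⟩ - δ j, ?_⟩
  rintro ⟨j, hj⟩
  induction j with
  | zero => rw [sum_Iic_mk_zero]; simp [h0]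
  | succ j ih =>
    rw [sum_Iic_mk_succ, ih]
    have := hδ j hj
    simp
    omega

theorem sum_univ_sum_Iic (c : Fin N → ℕ) :
    ∑ j, ∑ k ∈ Finset.Iic j, c k = ∑ k, (N - k) * c k := by
  have : ∀ j, ∑ k ∈ Finset.Iic j, c k = ∑ k, if k ≤ j then c k else 0 := by
    intro j
    rw [← Finset.sum_filter]
    congr 1
    ext; simp
  simp_rw [this]
  rw [Finset.sum_comm]
  refine Finset.sum_congr rfl fun k _ => ?_
  rw [← Finset.sum_filter, Finset.sum_const, smul_eq_mul]
  congr 1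
  rw [← Fin.card_Ici]
  congr 1
  ext; simp

/-- A truncated difference can be nonzero only for `i < j`, where it is the sum of `c` over `(i,
j]`, less one for an inversion. By `hw` that subtraction is exact. Each `c k` is counted by the `k *
(N - k)` pairs with `i < k ≤ j`. -/
theorem sum_sum_sub_add_card_inversionSet (w : Equiv.Perm (Fin N)) (c : Fin N → ℕ)
    (hw : ∀ i j, i < j → w j < w i → ∑ k ∈ Finset.Iic i, c k < ∑ k ∈ Finset.Iic j, c k) :
    ∑ i, ∑ j, (∑ k ∈ Finset.Iic j, c k -
        (∑ k ∈ Finset.Iic i, c k + if w j < w i then 1 else 0)) + (inversionSet w).card =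
      ∑ k : Fin N, k * (N - k) * c k := by
  have hinv : (inversionSet w).card =
      ∑ i, ∑ j, if i < j ∧ w j < w i then 1 else 0 := by
    rw [inversionSet, Finset.card_filter, ← Finset.univ_product_univ, Finset.sum_product]
  have key : ∀ i j : Fin N, (∑ k ∈ Finset.Iic j, c k -
        (∑ k ∈ Finset.Iic i, c k + if w j < w i then 1 else 0)) +
        (if i < j ∧ w j < w i then 1 else 0) =
      ∑ k, if i < k ∧ k ≤ j then c k else 0 := by
    intro i j
    have h1 : ∑ k, (if i < k ∧ k ≤ j then c k else 0) = ∑ k ∈ Finset.Ioc i j, c k := by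
      rw [← Finset.sum_filter]
      congr 1
      ext; simp
    rw [h1]
    rcases lt_or_ge i j with hij | hij
    · have h2 := sum_Iic_add_sum_Ioc c hij.le
      have h3 := hw i j hij
      by_cases hwij : w j < w i
      · have := h3 hwij
        simp only [hij, hwij, and_self, if_true]
        omega
      · simp only [hij, hwij, and_false, if_false]
        omega
    · have h2 := sum_Iic_monotone c hij
      simp only at h2
      rw [Finset.Ioc_eq_empty hij.not_gt]
      simp only [hij.not_gt, false_and, if_false, Finset.sum_empty]
      omega
  rw [hinv, ← Finset.sum_add_distrib]
  simp_rw [← Finset.sum_add_distrib, key]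
  have h4 : ∀ i : Fin N, ∑ j, ∑ k, (if i < k ∧ k ≤ j then c k else 0) =
      ∑ k, if i < k then (N - k) * c k else 0 := by
    intro i
    rw [Finset.sum_comm]
    refine Finset.sum_congr rfl fun k _ => ?_
    by_cases hik : i < k
    · simp only [hik, true_and, if_true]
      rw [← Finset.sum_filter, Finset.sum_const, smul_eq_mul, ← Fin.card_Ici]
      congr 2
      ext; simp
    · simp [hik]
  simp_rw [h4]
  rw [Finset.sum_comm]
  refine Finset.sum_congr rfl fun k _ => ?_
  rw [← Finset.sum_filter, Finset.sum_const, smul_eq_mul, mul_assoc]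
  congr 1
  rw [← Fin.card_Iio]
  congr 1
  ext; simp

end PartialSums

/-! ### Stable sorting: vectors as permutations with increments. -/

section Sorting

variable {N : ℕ}

/-- The function with increasing rearrangement given by the partial sums of `d`, augmented by one
at each descent of `w`, arranged along `w`. -/
noncomputable def arrangement (w : Equiv.Perm (Fin N)) (d : Fin N → ℕ) : Fin N → ℕ := fun x =>
  ∑ k ∈ Finset.Iic (w.symm x), (d k + if (k : ℕ) ∈ descentSet w then 1 else 0)

theorem arrangement_apply (w : Equiv.Perm (Fin N)) (d : Fin N → ℕ) (j : Fin N) :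
    arrangement w d (w j) =
      ∑ k ∈ Finset.Iic j, (d k + if (k : ℕ) ∈ descentSet w then 1 else 0) := by
  simp [arrangement]

theorem mem_descentSet_succ (w : Equiv.Perm (Fin N)) {i : ℕ} (hi : i + 1 < N) :
    i + 1 ∈ descentSet w ↔ w ⟨i + 1, hi⟩ < w ⟨i, by omega⟩ := by
  rw [mem_descentSet]
  simp [hi]

theorem apply_lt_of_sum_Iic_eq (w : Equiv.Perm (Fin N)) (d : Fin N → ℕ) {i j : Fin N} (hij : i < j)
    (h : ∑ k ∈ Finset.Iic i, (d k + if (k : ℕ) ∈ descentSet w then 1 else 0) =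
      ∑ k ∈ Finset.Iic j, (d k + if (k : ℕ) ∈ descentSet w then 1 else 0)) : w i < w j := by
  have h1 := sum_Iic_add_sum_Ioc (fun k => d k + if (k : ℕ) ∈ descentSet w then 1 else 0) hij.le
  have h2 : ∑ k ∈ Finset.Ioc i j, (d k + if (k : ℕ) ∈ descentSet w then 1 else 0) = 0 := by omega
  rw [Finset.sum_eq_zero_iff] at h2
  have h3 : ∀ k ∈ Finset.Ioc i j, (k : ℕ) ∉ descentSet w := by
    intro k hk hd
    have := h2 k hk
    rw [if_pos hd] at this
    omega
  clear h h1 h2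
  obtain ⟨i, hi⟩ := i
  obtain ⟨j, hj⟩ := j
  simp only [Fin.mk_lt_mk] at hij
  have hstep : ∀ l (hl : l + 1 < N), i ≤ l → l + 1 ≤ j → w ⟨l, by omega⟩ < w ⟨l + 1, hl⟩ := by
    intro l hl hil hlj
    have := h3 ⟨l + 1, hl⟩ (by simp [Finset.mem_Ioc, Fin.lt_def, Fin.le_def]; omega)
    rw [mem_descentSet_succ w hl, not_lt] at this
    refine lt_of_le_of_ne this fun heq => ?_
    have := congrArg Fin.val (w.injective heq)
    simp at this
  clear h3
  induction j, hij using Nat.le_induction with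
  | base => exact hstep i hj le_rfl le_rfl
  | succ j hij ih =>
    exact (ih (by omega) fun l hl hil hlj => hstep l hl hil (by omega)).trans
      (hstep j hj (by omega) le_rfl)

/-- The forced jumps at descents mean that `w` increases along any run of equal values, which is the
tie-breaking rule characterising `Tuple.sort`. -/
theorem sort_arrangement (w : Equiv.Perm (Fin N)) (d : Fin N → ℕ) :
    Tuple.sort (arrangement w d) = w := by
  rw [eq_comm, Tuple.eq_sort_iff]
  constructor
  · intro i j hij
    simp only [Function.comp_apply, arrangement_apply]
    exact sum_Iic_monotone _ hij
  · intro i j hij h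
    rw [arrangement_apply, arrangement_apply] at h
    exact apply_lt_of_sum_Iic_eq w d hij h

theorem arrangement_bijective :
    Function.Bijective fun q : Equiv.Perm (Fin N) × (Fin N → ℕ) => arrangement q.1 q.2 := by
  constructor
  · rintro ⟨w, d⟩ ⟨w', d'⟩ h
    simp only at h
    have hw : w = w' := by rw [← sort_arrangement w d, h, sort_arrangement]
    subst hw
    have : (fun k : Fin N => d k + if (k : ℕ) ∈ descentSet w then 1 else 0) =
        fun k => d' k + if (k : ℕ) ∈ descentSet w then 1 else 0 :=
      sum_Iic_injective fun j => by
        rw [← arrangement_apply w d, h, arrangement_apply]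
    have hd : d = d' := by
      funext k
      exact Nat.add_right_cancel (congrFun this k)
    rw [hd]
  · intro b
    set w := Tuple.sort b with hw
    obtain ⟨hmono, hties⟩ := Tuple.eq_sort_iff.1 hw
    -- At a descent of the sorting permutation a tie is impossible, so the sorted values jump by at
    -- least one and subtracting the descent indicator is legitimate.
    obtain ⟨d, hd⟩ := exists_sum_Iic_eq (a := b ∘ w)
      (fun k => if (k : ℕ) ∈ descentSet w then 1 else 0)
      (fun h0 => by simp [mem_descentSet])
      (fun i hi => by
        have hlt : (⟨i, by omega⟩ : Fin N) < ⟨i + 1, hi⟩ := by simp [Fin.lt_def]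
        have hle := hmono hlt.le
        by_cases hdes : i + 1 ∈ descentSet w
        · simp only [hdes, if_true]
          rw [mem_descentSet_succ w hi] at hdes
          have : b (w ⟨i, by omega⟩) ≠ b (w ⟨i + 1, hi⟩) :=
            fun heq => (hties _ _ hlt heq).not_gt hdes
          simp only [Function.comp_apply] at hle ⊢
          omega
        · simpa only [hdes, if_false, add_zero] using hle)
    refine ⟨(w, d), ?_⟩
    funext x
    have := hd (w.symm x)
    simpa [arrangement] using this

end Sorting

/-! ### Index, counting exponent and conductor in sorted coordinates. -/

section Weights

variable {N : ℕ}

/-- The exponent of the number of lattices whose value set has the data `b`. -/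
def latticeExponent (b : Fin N → ℕ) : ℕ :=
  ∑ j, b j + ∑ i, ∑ j, (b j - (b i + if j < i then 1 else 0))

/-- The conductor of a value set containing `0`, with data `b`. -/
noncomputable def conductorData (b : Fin N → ℕ) : ℕ :=
  sInf {k | ∀ i : Fin (N + 1), i + (N + 1) * (Fin.cons 0 b : Fin (N + 1) → ℕ) i < k + (N + 1)}

theorem sum_arrangement (w : Equiv.Perm (Fin N)) (d : Fin N → ℕ) :
    ∑ x, arrangement w d x =
      ∑ k : Fin N, (N - k) * (d k + if (k : ℕ) ∈ descentSet w then 1 else 0) := by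
  rw [← Equiv.sum_comp w]
  simp_rw [arrangement_apply]
  exact sum_univ_sum_Iic _

theorem latticeExponent_arrangement (w : Equiv.Perm (Fin N)) (d : Fin N → ℕ) :
    latticeExponent (arrangement w d) + (inversionSet w).card =
      ∑ k : Fin N, (k + 1) * (N - k) * (d k + if (k : ℕ) ∈ descentSet w then 1 else 0) := by
  have hre : ∑ i, ∑ j, (arrangement w d j - (arrangement w d i + if j < i then 1 else 0)) =
      ∑ i, ∑ j, (arrangement w d (w j) -
        (arrangement w d (w i) + if w j < w i then 1 else 0)) := by
    rw [← Equiv.sum_comp w]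
    exact Finset.sum_congr rfl fun i _ => (Equiv.sum_comp w _).symm
  rw [latticeExponent, sum_arrangement, add_assoc, hre]
  simp_rw [arrangement_apply]
  rw [sum_sum_sub_add_card_inversionSet, ← Finset.sum_add_distrib]
  · exact Finset.sum_congr rfl fun k _ => by ring
  · intro i j hij hw
    refine lt_of_le_of_ne (sum_Iic_monotone _ hij.le) fun heq => ?_
    exact (apply_lt_of_sum_Iic_eq w d hij heq).not_gt hw

/-- The largest generator belongs to the class of `w`'s last letter: it has the greatest value and,
by stability, the greatest class among ties. The conductor is this maximum lowered by the period
less one. -/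
theorem conductorData_arrangement (w : Equiv.Perm (Fin N)) (d : Fin N → ℕ) :
    conductorData (arrangement w d) + parabolicLength (Finset.Icc 1 (N + 1 - 3)) w =
      (N + 1) * ∑ k : Fin N, (d k + if (k : ℕ) ∈ descentSet w then 1 else 0) := by
  cases N with
  -- With no letters there is no last one; both terms on the left vanish.
  | zero =>
    have h1 : conductorData (arrangement w d) = 0 := by
      refine Nat.eq_zero_of_le_zero (Nat.sInf_le fun i => ?_)
      rw [Fin.eq_zero i]
      simp
    have h2 : parabolicLength ∅ w = 0 := by
      refine Nat.eq_zero_of_le_zero (Nat.sInf_le ⟨1, Subgroup.one_mem _, ?_⟩)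
      rw [coxeterLength_eq_card_inversionSet]
      simp [inversionSet]
    simp [h1, h2]
  | succ N =>
    have hpar := parabolicLength_eq w
    rw [show N + 1 + 1 - 3 = N - 1 by omega, hpar]
    set c : Fin (N + 1) → ℕ := fun k => d k + if (k : ℕ) ∈ descentSet w then 1 else 0 with hc
    have hlast : arrangement w d (w (Fin.last N)) = ∑ k, c k := by
      rw [arrangement_apply]
      congr 1
      ext k
      simp [Fin.le_last]
    have hwl := (w (Fin.last N)).2
    have hmax : ∀ x : Fin (N + 1), (x : ℕ) + (N + 2) * arrangement w d x ≤
        (w (Fin.last N) : ℕ) + (N + 2) * ∑ k, c k := by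
      intro x
      obtain ⟨j, rfl⟩ := w.surjective x
      rw [← hlast]
      rcases (Fin.le_last j).lt_or_eq with hj | rfl
      · have hle : arrangement w d (w j) ≤ arrangement w d (w (Fin.last N)) := by
          rw [arrangement_apply, arrangement_apply]
          exact sum_Iic_monotone _ hj.le
        rcases hle.lt_or_eq with hlt | heq
        · have := Nat.mul_le_mul_left (N + 2) hlt
          have hx := (w j).2
          rw [Nat.mul_succ] at this
          omega
        · rw [heq]
          rw [arrangement_apply, arrangement_apply] at heq
          have : (w j : ℕ) < w (Fin.last N) := apply_lt_of_sum_Iic_eq w d hj heq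
          omega
      · exact le_rfl
    -- Comparing the greatest letter with the maximum shows that the truncated subtraction below is
    -- exact.
    have hdes : N - (w (Fin.last N) : ℕ) ≤ (N + 1 + 1) * ∑ k, c k := by
      have h0 := hmax ⟨N, by omega⟩
      have : N ≤ (w (Fin.last N) : ℕ) + (N + 2) * ∑ k, c k := by
        refine le_trans ?_ h0
        simp
      have h3 : (N + 1 + 1) = N + 2 := rfl
      rw [h3]
      omega
    suffices h : conductorData (arrangement w d) =
        (N + 1 + 1) * ∑ k, c k - (N - (w (Fin.last N) : ℕ)) by
      rw [h]
      exact Nat.sub_add_cancel hdes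
    have hset : {k | ∀ i : Fin (N + 1 + 1), (i : ℕ) + (N + 1 + 1) *
        (Fin.cons 0 (arrangement w d) : Fin (N + 1 + 1) → ℕ) i < k + (N + 1 + 1)} =
        Set.Ici ((N + 1 + 1) * ∑ k, c k - (N - (w (Fin.last N) : ℕ))) := by
      ext k
      simp only [Set.mem_ofPred_eq, Set.mem_Ici, Fin.forall_fin_succ (n := N + 1), Fin.cons_zero,
        Fin.cons_succ]
      constructor
      · rintro ⟨-, h⟩
        have := h (w (Fin.last N))
        rw [hlast, Fin.val_succ] at this
        omega
      · intro hk
        refine ⟨by simp, fun x => ?_⟩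
        have := hmax x
        rw [Fin.val_succ]
        have h3 : (N + 1 + 1) = N + 2 := rfl
        rw [h3] at hk ⊢
        omega
    rw [conductorData, hset, csInf_Ici]

end Weights

/-! ### Summation over fibres and over sorted vectors. -/

section Sums

theorem hasSum_sigma_of_finite {β : Type*} {F : β → Type*} [∀ b, Finite (F b)] {g : β → ℂ} {a : ℂ}
    (ha : HasSum (fun b => (Nat.card (F b) : ℂ) * g b) a) :
    HasSum (fun q : Σ b, F b => g q.1) a := by
  have hfin : ∀ b, Fintype (F b) := fun b => Fintype.ofFinite _
  have hsum : ∀ b, HasSum (fun _ : F b => g b) ((Nat.card (F b) : ℂ) * g b) := by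
    intro b
    convert hasSum_fintype (fun _ : F b => g b) using 1
    simp
  have hs : Summable (fun q : Σ b, F b => g q.1) := by
    rw [← summable_norm_iff, summable_sigma_of_nonneg fun _ => norm_nonneg _]
    refine ⟨fun b => (hasSum_fintype _).summable, ?_⟩
    convert ha.summable.norm using 2 with b
    simp
  have h2 := hs.hasSum.sigma hsum
  rw [← h2.unique ha]
  exact hs.hasSum

theorem hasSum_prod_of_fintype_left {ι β : Type*} [Fintype ι] {f : ι → β → ℂ} {a : ι → ℂ}
    (h : ∀ i, HasSum (f i) (a i)) : HasSum (fun q : ι × β => f q.1 q.2) (∑ i, a i) := by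
  have hs : Summable (fun q : ι × β => f q.1 q.2) := by
    rw [← summable_norm_iff, summable_prod_of_nonneg fun _ => norm_nonneg _]
    exact ⟨fun i => (h i).summable.norm, (hasSum_fintype _).summable⟩
  rw [(hasSum_fintype a).unique (hs.hasSum.prod_fiberwise h)]
  exact hs.hasSum

theorem hasSum_mul_prod {ι κ : Type*} {f : ι → ℂ} {g : κ → ℂ} {a b : ℂ} (hf : HasSum f a)
    (hg : HasSum g b) : HasSum (fun q : ι × κ => f q.1 * g q.2) (a * b) :=
  hf.mul hg (summable_mul_of_summable_norm hf.summable.norm hg.summable.norm)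

theorem hasSum_prod_pow {N : ℕ} (x : Fin N → ℂ) (hx : ∀ k, ‖x k‖ < 1) :
    HasSum (fun d : Fin N → ℕ => ∏ k, x k ^ d k) (∏ k, (1 - x k)⁻¹) := by
  induction N with
  | zero =>
    simp only [Finset.univ_eq_empty, Finset.prod_empty]
    exact hasSum_unique (fun _ : Fin 0 → ℕ => (1 : ℂ))
  | succ N ih =>
    rw [← (Fin.consEquiv fun _ : Fin (N + 1) => ℕ).hasSum_iff]
    rw [Fin.prod_univ_succ]
    convert hasSum_mul_prod (hasSum_geometric_of_norm_lt_one (hx 0))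
      (ih (fun k => x k.succ) fun k => hx _) using 1
    funext q
    simp [Fin.prod_univ_succ]

theorem hasSum_composition {N : ℕ} {X Y q : ℂ} (hY : Y ≠ 0) (hq : q ≠ 0) (x : ℕ → ℂ)
    (hxd : ∀ k : Fin N, x k = X ^ (N - (k : ℕ)) * Y ^ (N + 1) * q ^ (((k : ℕ) + 1) * (N - k)))
    (hx : ∀ k : Fin N, ‖x k‖ < 1) :
    HasSum (fun b : Fin N → ℕ => q ^ latticeExponent b * (X ^ (∑ j, b j) * Y ^ conductorData b))
      ((∑ w : Equiv.Perm (Fin N), (q⁻¹ ^ coxeterLength w *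
        Y⁻¹ ^ parabolicLength (Finset.Icc 1 (N + 1 - 3)) w) * ∏ j ∈ descentSet w, x j) *
          ∏ k : Fin N, (1 - x k)⁻¹) := by
  rw [← (Equiv.ofBijective _ (arrangement_bijective (N := N))).hasSum_iff, Finset.sum_mul]
  have key : ∀ w : Equiv.Perm (Fin N), ∀ d : Fin N → ℕ,
      q ^ latticeExponent (arrangement w d) * (X ^ (∑ j, arrangement w d j) *
        Y ^ conductorData (arrangement w d)) =
      ((q⁻¹ ^ coxeterLength w * Y⁻¹ ^ parabolicLength (Finset.Icc 1 (N + 1 - 3)) w) *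
        ∏ j ∈ descentSet w, x j) * ∏ k : Fin N, x k ^ d k := by
    intro w d
    set δ : Fin N → ℕ := fun k => if (k : ℕ) ∈ descentSet w then 1 else 0 with hδ
    have h1 := sum_arrangement w d
    have h2 := latticeExponent_arrangement w d
    have h3 := conductorData_arrangement w d
    have h4 : ∏ j ∈ descentSet w, x j = ∏ k : Fin N, x k ^ δ k := by
      have : descentSet w = (Finset.univ.filter fun k : Fin N => (k : ℕ) ∈ descentSet w).map
          Fin.valEmbedding := by
        ext j
        simp only [Finset.mem_map, Finset.mem_filter, Finset.mem_univ, true_and,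
          Fin.valEmbedding_apply]
        constructor
        · intro hj
          obtain ⟨hj', -⟩ := (mem_descentSet w).1 hj
          exact ⟨⟨j, hj'.2⟩, hj, rfl⟩
        · rintro ⟨k, hk, rfl⟩
          exact hk
      rw [this, Finset.prod_map, Finset.prod_filter]
      refine Finset.prod_congr rfl fun k _ => ?_
      by_cases hk : (k : ℕ) ∈ descentSet w <;> simp [hδ, hk]
    -- The descent factors merge with the increments into one exponent per position, after which the
    -- three weight formulas are read off factor by factor.
    have h5 : (∏ j ∈ descentSet w, x j) * ∏ k : Fin N, x k ^ d k =
        X ^ (∑ j, arrangement w d j) * Y ^ (conductorData (arrangement w d) +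
          parabolicLength (Finset.Icc 1 (N + 1 - 3)) w) *
          q ^ (latticeExponent (arrangement w d) + (inversionSet w).card) := by
      rw [h4, ← Finset.prod_mul_distrib, h1, h2, h3, Finset.mul_sum,
        ← Finset.prod_pow_eq_pow_sum, ← Finset.prod_pow_eq_pow_sum, ← Finset.prod_pow_eq_pow_sum,
        ← Finset.prod_mul_distrib, ← Finset.prod_mul_distrib]
      refine Finset.prod_congr rfl fun k _ => ?_
      rw [← pow_add, hxd, mul_pow, mul_pow, ← pow_mul, ← pow_mul, ← pow_mul, add_comm (δ k)]
    rw [mul_assoc _ (∏ j ∈ descentSet w, x j), h5, coxeterLength_eq_card_inversionSet, pow_add,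
      pow_add, inv_pow, inv_pow]
    field_simp
  convert hasSum_prod_of_fintype_left (fun w : Equiv.Perm (Fin N) =>
    (hasSum_prod_pow (fun k : Fin N => x k) hx).mul_left
      ((q⁻¹ ^ coxeterLength w * Y⁻¹ ^ parabolicLength (Finset.Icc 1 (N + 1 - 3)) w) *
        ∏ j ∈ descentSet w, x j)) using 1
  funext r
  exact key r.1 r.2

end Sums

/-! ### Cofinite sets of naturals closed under a fixed shift. -/

section ValueSets

variable {N : ℕ}

/-- The generators modulo `N + 1` of the value set with minimum `t` and data `b`. -/
def valueGen (t : ℕ) (b : Fin N → ℕ) (i : Fin (N + 1)) : ℕ :=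
  t + i + (N + 1) * (Fin.cons 0 b : Fin (N + 1) → ℕ) i

/-- The set of natural numbers closed under addition of `N + 1` with minimum `t` and data `b`. -/
def valueSetOf (t : ℕ) (b : Fin N → ℕ) : Set ℕ := {k | ∃ i j, k = valueGen t b i + (N + 1) * j}

theorem Fin.eq_of_add_mul_eq {i i' : Fin (N + 1)} {t u u' : ℕ}
    (h : t + i + (N + 1) * u = t + i' + (N + 1) * u') : i = i' ∧ u = u' := by
  have h1 : (i : ℕ) + (N + 1) * u = i' + (N + 1) * u' := by omega
  have h2 := congrArg (· % (N + 1)) h1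
  simp only [Nat.add_mul_mod_self_left, Nat.mod_eq_of_lt i.2, Nat.mod_eq_of_lt i'.2] at h2
  refine ⟨Fin.ext h2, ?_⟩
  rw [h2] at h1
  exact Nat.eq_of_mul_eq_mul_left (Nat.succ_pos N) (Nat.add_left_cancel h1)

theorem exists_eq_add_mul {t k : ℕ} (h : t ≤ k) :
    ∃ (j : Fin (N + 1)) (u : ℕ), k = t + j + (N + 1) * u := by
  refine ⟨⟨(k - t) % (N + 1), Nat.mod_lt _ (Nat.succ_pos N)⟩, (k - t) / (N + 1), ?_⟩
  have := Nat.mod_add_div (k - t) (N + 1)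
  simp only
  omega

theorem le_of_mem_valueSetOf {t : ℕ} {b : Fin N → ℕ} {k : ℕ} (hk : k ∈ valueSetOf t b) :
    t ≤ k := by
  obtain ⟨i, j, rfl⟩ := hk
  rw [valueGen]
  omega

theorem add_mul_mem_valueSetOf {t : ℕ} {b : Fin N → ℕ} {j : Fin (N + 1)} {u : ℕ} :
    t + j + (N + 1) * u ∈ valueSetOf t b ↔ (Fin.cons 0 b : Fin (N + 1) → ℕ) j ≤ u := by
  constructor
  · rintro ⟨i, l, h⟩
    rw [valueGen, add_assoc _ ((N + 1) * _), ← Nat.mul_add] at h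
    obtain ⟨rfl, rfl⟩ := Fin.eq_of_add_mul_eq h
    exact Nat.le_add_right _ _
  · intro h
    refine ⟨j, u - (Fin.cons 0 b : Fin (N + 1) → ℕ) j, ?_⟩
    rw [valueGen, add_assoc _ ((N + 1) * _), ← Nat.mul_add, Nat.add_sub_cancel' h]

theorem valueGen_mod_injective (t : ℕ) (b : Fin N → ℕ) :
    Function.Injective fun i => valueGen t b i % (N + 1) := by
  intro i i' h
  simp only [valueGen, Nat.add_mul_mod_self_left] at h
  have h2 : (i : ℕ) % (N + 1) = i' % (N + 1) := Nat.ModEq.add_left_cancel' t h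
  rw [Nat.mod_eq_of_lt i.2, Nat.mod_eq_of_lt i'.2] at h2
  exact Fin.ext h2

/-- The embedding of pairs of a residue class and a quotient into the natural numbers. -/
def classEmbedding (N t : ℕ) : (Σ _ : Fin (N + 1), ℕ) ↪ ℕ where
  toFun q := t + q.1 + (N + 1) * q.2
  inj' := by
    rintro ⟨j, u⟩ ⟨j', u'⟩ h
    obtain ⟨rfl, rfl⟩ := Fin.eq_of_add_mul_eq h
    rfl

theorem mem_map_classEmbedding {t g : ℕ} {A : Fin (N + 1) → Finset ℕ} :
    g ∈ (Finset.univ.sigma A).map (classEmbedding N t) ↔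
      ∃ j, ∃ u ∈ A j, g = t + j + (N + 1) * u := by
  simp only [Finset.mem_map, Finset.mem_sigma, Finset.mem_univ, true_and, classEmbedding,
    Sigma.exists]
  constructor
  · rintro ⟨j, u, hu, rfl⟩; exact ⟨j, u, hu, rfl⟩
  · rintro ⟨j, u, hu, rfl⟩; exact ⟨j, u, hu, rfl⟩

/-- The gaps of a value set that exceed its `i`-th generator. -/
def gapsAbove (t : ℕ) (b : Fin N → ℕ) (i : Fin (N + 1)) : Finset ℕ :=
  (Finset.univ.sigma fun j : Fin (N + 1) =>
    Finset.Ico ((Fin.cons 0 b : Fin (N + 1) → ℕ) i + if j < i then 1 else 0)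
      ((Fin.cons 0 b : Fin (N + 1) → ℕ) j)).map (classEmbedding N t)

theorem mem_gapsAbove {t : ℕ} {b : Fin N → ℕ} {i : Fin (N + 1)} {g : ℕ} :
    g ∈ gapsAbove t b i ↔ valueGen t b i + 1 ≤ g ∧ g ∉ valueSetOf t b := by
  rw [gapsAbove, mem_map_classEmbedding]
  -- Lexicographic comparison: first by quotient, then by class, which is where the indicator of `j
  -- < i` comes from.
  have key : ∀ (j : Fin (N + 1)) (u : ℕ),
      valueGen t b i + 1 ≤ t + j + (N + 1) * u ↔ j ≠ i ∧
        (Fin.cons 0 b : Fin (N + 1) → ℕ) i + (if j < i then 1 else 0) ≤ u ∨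
        j = i ∧ (Fin.cons 0 b : Fin (N + 1) → ℕ) i < u := by
    intro j u
    rw [valueGen]
    generalize (Fin.cons 0 b : Fin (N + 1) → ℕ) i = v
    have hi := i.2
    have hj := j.2
    rcases lt_trichotomy u v with huv | rfl | huv
    · have := Nat.mul_le_mul_left (N + 1) huv
      rw [Nat.mul_succ] at this
      constructor
      · omega
      · split_ifs <;> omega
    · simp only [Fin.lt_def, Fin.ext_iff, ne_eq]
      split_ifs <;> omega
    · have := Nat.mul_le_mul_left (N + 1) huv
      rw [Nat.mul_succ] at this
      simp only [Fin.lt_def, Fin.ext_iff, ne_eq]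
      split_ifs <;> omega
  constructor
  · rintro ⟨j, u, hu, rfl⟩
    rw [Finset.mem_Ico] at hu
    rw [add_mul_mem_valueSetOf, key, not_le]
    refine ⟨?_, hu.2⟩
    by_cases hji : j = i
    · subst hji
      simp at hu
      omega
    · exact Or.inl ⟨hji, hu.1⟩
  · rintro ⟨h1, h2⟩
    obtain ⟨j, u, rfl⟩ := exists_eq_add_mul (N := N) (t := t) (k := g)
      (by rw [valueGen] at h1; omega)
    rw [add_mul_mem_valueSetOf, not_le] at h2
    refine ⟨j, u, ?_, rfl⟩
    rw [Finset.mem_Ico]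
    refine ⟨?_, h2⟩
    rcases (key j u).1 h1 with h | ⟨rfl, h⟩
    · exact h.2
    · omega

theorem sum_card_gapsAbove (t : ℕ) (b : Fin N → ℕ) :
    ∑ i, (gapsAbove t b i).card = latticeExponent b := by
  simp only [gapsAbove, Finset.card_map, Finset.card_sigma, Nat.card_Ico]
  rw [Fin.sum_univ_succ, latticeExponent]
  congr 1
  · rw [Fin.sum_univ_succ]
    simp
  · refine Finset.sum_congr rfl fun i _ => ?_
    rw [Fin.sum_univ_succ]
    simp [Fin.succ_lt_succ_iff]

/-- The complement of a value set. -/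
def allGaps (t : ℕ) (b : Fin N → ℕ) : Finset ℕ :=
  Finset.range t ∪ (Finset.univ.sigma fun j : Fin (N + 1) =>
    Finset.range ((Fin.cons 0 b : Fin (N + 1) → ℕ) j)).map (classEmbedding N t)

theorem mem_allGaps {t : ℕ} {b : Fin N → ℕ} {g : ℕ} :
    g ∈ allGaps t b ↔ g ∉ valueSetOf t b := by
  rw [allGaps, Finset.mem_union, mem_map_classEmbedding, Finset.mem_range]
  constructor
  · rintro (h | ⟨j, u, hu, rfl⟩)
    · exact fun hg => absurd (le_of_mem_valueSetOf hg) (not_le.2 h)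
    · rw [add_mul_mem_valueSetOf, not_le]
      exact Finset.mem_range.1 hu
  · intro hg
    rcases lt_or_ge g t with h | h
    · exact Or.inl h
    · obtain ⟨j, u, rfl⟩ := exists_eq_add_mul (N := N) h
      rw [add_mul_mem_valueSetOf, not_le] at hg
      exact Or.inr ⟨j, u, Finset.mem_range.2 hg, rfl⟩

theorem card_allGaps (t : ℕ) (b : Fin N → ℕ) : (allGaps t b).card = t + ∑ j, b j := by
  rw [allGaps, Finset.card_union_of_disjoint, Finset.card_map, Finset.card_sigma,
    Fin.sum_univ_succ]
  · simp
  · rw [Finset.disjoint_left]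
    intro g hg
    rw [mem_map_classEmbedding]
    rintro ⟨j, u, -, rfl⟩
    rw [Finset.mem_range] at hg
    omega

theorem finite_compl_valueSetOf (t : ℕ) (b : Fin N → ℕ) : (valueSetOf t b)ᶜ.Finite :=
  (allGaps t b).finite_toSet.subset fun _ hg => mem_allGaps.2 hg

/-- One period below a generator lies the largest missing element of its class. The inequality is
kept additive because that position may be negative. -/
theorem forall_mem_valueSetOf_iff {t : ℕ} {b : Fin N → ℕ} {k : ℕ} :
    (∀ j, k ≤ j → j ∈ valueSetOf t b) ↔ ∀ i, valueGen t b i < k + (N + 1) := by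
  constructor
  · intro h i
    by_contra hcon
    rw [not_lt] at hcon
    have h1 := h (valueGen t b i - (N + 1)) (by omega)
    have hle := le_of_mem_valueSetOf h1
    obtain ⟨i', l, hil⟩ := h1
    have h2 : valueGen t b i = valueGen t b i' + (N + 1) * (l + 1) := by
      rw [Nat.mul_succ]; omega
    have h3 : i = i' := valueGen_mod_injective t b (by
      simp only [h2, Nat.add_mul_mod_self_left])
    rw [h3, Nat.mul_succ] at h2
    omega
  · intro h l hl
    have ht : t ≤ k := by
      have := h (Fin.last N)
      rw [valueGen, Fin.val_last] at this
      omega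
    obtain ⟨j, u, rfl⟩ := exists_eq_add_mul (N := N) (ht.trans hl)
    rw [add_mul_mem_valueSetOf]
    have h1 := h j
    rw [valueGen] at h1
    have h2 : (N + 1) * (Fin.cons 0 b : Fin (N + 1) → ℕ) j < (N + 1) * (u + 1) := by
      rw [Nat.mul_succ]; omega
    exact Nat.lt_succ_iff.1 (Nat.lt_of_mul_lt_mul_left h2)

theorem sInf_forall_mem_valueSetOf (t : ℕ) (b : Fin N → ℕ) :
    sInf {k | ∀ j, k ≤ j → j ∈ valueSetOf t b} = t + conductorData b := by
  set A : Set ℕ := {k | ∀ i : Fin (N + 1),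
    i + (N + 1) * (Fin.cons 0 b : Fin (N + 1) → ℕ) i < k + (N + 1)} with hA
  have hmem : ∀ k, k ∈ {k | ∀ j, k ≤ j → j ∈ valueSetOf t b} ↔ t ≤ k ∧ k - t ∈ A := by
    intro k
    rw [Set.mem_ofPred_eq, forall_mem_valueSetOf_iff]
    constructor
    · intro h
      have ht : t ≤ k := by
        have := h (Fin.last N)
        rw [valueGen, Fin.val_last] at this
        omega
      refine ⟨ht, fun i => ?_⟩
      have := h i
      rw [valueGen] at this
      omega
    · rintro ⟨ht, h⟩ i
      have := h i
      rw [valueGen]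
      omega
  have hne : A.Nonempty := by
    refine ⟨∑ i : Fin (N + 1), (i + (N + 1) * (Fin.cons 0 b : Fin (N + 1) → ℕ) i), fun i => ?_⟩
    have := Finset.single_le_sum (f := fun i : Fin (N + 1) =>
      (i : ℕ) + (N + 1) * (Fin.cons 0 b : Fin (N + 1) → ℕ) i) (fun _ _ => Nat.zero_le _)
      (Finset.mem_univ i)
    omega
  have hc : conductorData b ∈ A := Nat.sInf_mem hne
  apply le_antisymm
  · exact Nat.sInf_le ((hmem _).2 ⟨Nat.le_add_right _ _, by rwa [Nat.add_sub_cancel_left]⟩)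
  · refine le_csInf ⟨_, (hmem _).2 ⟨Nat.le_add_right t _, by rwa [Nat.add_sub_cancel_left]⟩⟩ ?_
    intro k hk
    obtain ⟨h1, h2⟩ := (hmem k).1 hk
    have : conductorData b ≤ k - t := Nat.sInf_le h2
    omega

theorem valueSetOf_injective {t t' : ℕ} {b b' : Fin N → ℕ}
    (h : valueSetOf t b = valueSetOf t' b') : t = t' ∧ b = b' := by
  have hmin : ∀ (t : ℕ) (b : Fin N → ℕ), t ∈ valueSetOf t b := fun t b =>
    ⟨0, 0, by simp [valueGen]⟩
  have ht : t = t' := le_antisymm (le_of_mem_valueSetOf (h ▸ hmin t' b'))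
    (le_of_mem_valueSetOf (h ▸ hmin t b))
  subst ht
  refine ⟨rfl, funext fun j => ?_⟩
  have h1 : ∀ u, b j ≤ u ↔ b' j ≤ u := by
    intro u
    have h1 := add_mul_mem_valueSetOf (t := t) (b := b) (j := j.succ) (u := u)
    have h2 := add_mul_mem_valueSetOf (t := t) (b := b') (j := j.succ) (u := u)
    rw [← h, h1] at h2
    simpa using h2
  exact le_antisymm ((h1 _).2 le_rfl) ((h1 _).1 le_rfl)

/-- Within each residue class the set is upward closed, hence determined by its least element;
cofiniteness makes every class occur. -/
theorem exists_eq_valueSetOf {S : Set ℕ} (hS : ∀ k ∈ S, ∀ j, k + (N + 1) * j ∈ S)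
    (hcof : ∃ K, ∀ k, K ≤ k → k ∈ S) : ∃ t, ∃ b : Fin N → ℕ, S = valueSetOf t b := by
  obtain ⟨K, hK⟩ := hcof
  have ht := Nat.sInf_mem (⟨K, hK K le_rfl⟩ : S.Nonempty)
  set t := sInf S
  have hne : ∀ j : Fin N, {u | t + j.succ + (N + 1) * u ∈ S}.Nonempty := by
    intro j
    refine ⟨K, hK _ ?_⟩
    nlinarith
  refine ⟨t, fun j => sInf {u | t + j.succ + (N + 1) * u ∈ S}, ?_⟩
  have key : ∀ (j : Fin (N + 1)) (u : ℕ), t + j + (N + 1) * u ∈ S ↔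
      (Fin.cons 0 (fun j : Fin N => sInf {u | t + j.succ + (N + 1) * u ∈ S}) :
        Fin (N + 1) → ℕ) j ≤ u := by
    intro j u
    refine Fin.cases ?_ (fun j => ?_) j
    · simpa using hS t ht u
    · rw [Fin.cons_succ]
      refine ⟨fun h => Nat.sInf_le h, fun h => ?_⟩
      have hmem : t + j.succ + (N + 1) * sInf {u | t + j.succ + (N + 1) * u ∈ S} ∈ S :=
        Nat.sInf_mem (hne j)
      have h1 := hS _ hmem (u - sInf {u | t + j.succ + (N + 1) * u ∈ S})
      rwa [add_assoc _ ((N + 1) * _), ← Nat.mul_add, Nat.add_sub_cancel' h] at h1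
  ext k
  constructor
  · intro hk
    obtain ⟨j, u, rfl⟩ := exists_eq_add_mul (N := N) (Nat.sInf_le hk)
    rwa [add_mul_mem_valueSetOf, ← key]
  · intro hk
    obtain ⟨j, u, rfl⟩ := exists_eq_add_mul (N := N) (le_of_mem_valueSetOf hk)
    rwa [add_mul_mem_valueSetOf, ← key] at hk

end ValueSets

/-! ### The sum over lattices by index and conductor. -/

section LatticeSum

variable {R : Type*} [CommRing R] [IsDomain R] [IsDiscreteValuationRing R]

/-- The least `k` such that `M` contains all multiples of `π ^ k`. -/
noncomputable def latticeConductor {R : Type*} [CommRing R] (π : R) (M : AddSubgroup R) : ℕ :=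
  sInf {k | ∀ x, π ^ k ∣ x → x ∈ M}

namespace IsTotallyRamifiedAt

variable {p N : ℕ} {π : R} (h : IsTotallyRamifiedAt p (N + 1) π)
include h

theorem exists_valueSet_eq_valueSetOf {M : AddSubgroup R} (hK : ∃ K, ∀ x, π ^ K ∣ x → x ∈ M) :
    ∃ t, ∃ b : Fin N → ℕ, valueSet M = valueSetOf t b := by
  obtain ⟨K, hK'⟩ := id hK
  exact exists_eq_valueSetOf (fun k hk j => h.add_mem_valueSet hk j)
    ⟨K, (h.forall_mem_iff hK K).1 hK'⟩

/-- The generating function of lattices by index and conductor. -/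
theorem hasSum_lattice [CharZero R] {X Y : ℂ} (hY : Y ≠ 0) {φ : ℕ → ℂ}
    (hφ : ∀ k, φ (p ^ k) = X ^ k) (x : ℕ → ℂ)
    (hxd : ∀ k : Fin N,
      x k = X ^ (N - (k : ℕ)) * Y ^ (N + 1) * (p : ℂ) ^ (((k : ℕ) + 1) * (N - k)))
    (hx : ∀ k : Fin N, ‖x k‖ < 1) (hXY : ‖X * Y‖ < 1) :
    HasSum (fun M : {M : AddSubgroup R // M.index ≠ 0} =>
        φ M.1.index * Y ^ latticeConductor π M.1)
      ((1 - X * Y)⁻¹ * ((∑ w : Equiv.Perm (Fin N), ((p : ℂ)⁻¹ ^ coxeterLength w *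
        Y⁻¹ ^ parabolicLength (Finset.Icc 1 (N + 1 - 3)) w) * ∏ j ∈ descentSet w, x j) *
          ∏ k : Fin N, (1 - x k)⁻¹)) := by
  set F : ℕ × (Fin N → ℕ) → Type _ := fun q =>
    {M : AddSubgroup R // (∃ K, ∀ x, π ^ K ∣ x → x ∈ M) ∧ valueSet M = valueSetOf q.1 q.2} with hF
  have hequiv : ∀ q : ℕ × (Fin N → ℕ),
      Nonempty (F q ≃ (∀ i, gapsAbove q.1 q.2 i → Fin p)) := fun q =>
    h.card_valueSet_eq (fun k => Iff.rfl) (finite_compl_valueSetOf _ _)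
      (valueGen_mod_injective _ _) (fun i g => mem_gapsAbove)
  have hfin : ∀ q, Finite (F q) := fun q => by
    obtain ⟨e⟩ := hequiv q
    exact Finite.of_equiv _ e.symm
  have hcard : ∀ q : ℕ × (Fin N → ℕ), Nat.card (F q) = p ^ latticeExponent q.2 := by
    intro q
    obtain ⟨e⟩ := hequiv q
    rw [Nat.card_congr e, ← sum_card_gapsAbove q.1, ← Finset.prod_pow_eq_pow_sum]
    simp
  let f : (Σ q, F q) → {M : AddSubgroup R // M.index ≠ 0} :=
    fun a => ⟨a.2.1, h.index_ne_zero_iff.2 a.2.2.1⟩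
  have hf : Function.Bijective f := by
    constructor
    · rintro ⟨⟨t, b⟩, M, hM⟩ ⟨⟨t', b'⟩, M', hM'⟩ heq
      have hMM : M = M' := congrArg Subtype.val heq
      subst hMM
      obtain ⟨rfl, rfl⟩ := valueSetOf_injective (hM.2.symm.trans hM'.2)
      rfl
    · rintro ⟨M, hM⟩
      have hK := h.index_ne_zero_iff.1 hM
      obtain ⟨t, b, htb⟩ := h.exists_valueSet_eq_valueSetOf hK
      exact ⟨⟨(t, b), M, hK, htb⟩, rfl⟩
  rw [← (Equiv.ofBijective f hf).hasSum_iff]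
  have hval : ((fun M : {M : AddSubgroup R // M.index ≠ 0} =>
      φ M.1.index * Y ^ latticeConductor π M.1) ∘ Equiv.ofBijective f hf) =
      fun a => X ^ (a.1.1 + ∑ j, a.1.2 j) * Y ^ (a.1.1 + conductorData a.1.2) := by
    funext a
    obtain ⟨⟨t, b⟩, M, hK, hM⟩ := a
    have h1 : M.index = p ^ (t + ∑ j, b j) := by
      rw [h.index_eq hK (F := allGaps t b) (fun g => by rw [mem_allGaps, hM]), card_allGaps]
    have h2 : latticeConductor π M = t + conductorData b := by
      rw [latticeConductor, ← sInf_forall_mem_valueSetOf]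
      congr 1
      ext k
      rw [Set.mem_ofPred_eq, Set.mem_ofPred_eq, h.forall_mem_iff hK, hM]
    change φ M.index * Y ^ latticeConductor π M = _
    rw [h1, h2, hφ]
  rw [hval]
  apply hasSum_sigma_of_finite (F := F) (g := fun q : ℕ × (Fin N → ℕ) =>
    X ^ (q.1 + ∑ j, q.2 j) * Y ^ (q.1 + conductorData q.2))
  have hp : (p : ℂ) ≠ 0 := by exact_mod_cast h.prime.ne_zero
  -- The minimum `t` shifts index exponent and conductor alike and does not affect the count, so it
  -- splits off as a geometric series in `X * Y`.
  convert hasSum_mul_prod (hasSum_geometric_of_norm_lt_one hXY)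
    (hasSum_composition hY hp x hxd hx) using 1
  funext q
  rw [hcard]
  push_cast
  ring

end IsTotallyRamifiedAt

end LatticeSum

/-! ### From sums over subgroups to L-series. -/

section NormalZeta

theorem finite_of_summable_const {ι : Type*} {c : ℂ} (hc : c ≠ 0)
    (h : Summable fun _ : ι => c) : Finite ι := by
  by_contra hinf
  rw [not_finite_iff_infinite] at hinf
  exact hc ((summable_const_iff c).1 h)

/-- A sum over all normal subgroups of finite index as an L-series, when these are all open. -/
theorem LSeriesHasSum_normalCount {G : Type*} [Group G] [TopologicalSpace G]
    (hopen : ∀ N : Subgroup G, N.Normal → N.index ≠ 0 → IsOpen (N : Set G)) {s a : ℂ}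
    (hs : HasSum (fun N : {N : Subgroup G // N.Normal ∧ N.index ≠ 0} => (N.1.index : ℂ) ^ (-s)) a) :
    (∀ m : ℕ, 0 < m → (openNormalSubgroups G m).Finite) ∧
      LSeriesHasSum (normalCount G) s a := by
  set Φ : {N : Subgroup G // N.Normal ∧ N.index ≠ 0} → ℕ := fun N => N.1.index with hΦ
  have hequiv : ∀ m, m ≠ 0 → Nonempty ({N // Φ N = m} ≃ openNormalSubgroups G m) := fun m hm =>
    ⟨⟨fun N => ⟨N.1.1, N.1.2.1, hopen _ N.1.2.1 N.1.2.2, N.2⟩,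
      fun N => ⟨⟨N.1, N.2.1, by rw [N.2.2.2]; exact hm⟩, N.2.2.2⟩,
      fun _ => rfl, fun _ => rfl⟩⟩
  have hfin : ∀ m, Finite {N // Φ N = m} := by
    intro m
    rcases eq_or_ne m 0 with rfl | hm
    · have : IsEmpty {N // Φ N = 0} := ⟨fun N => N.1.2.2 N.2⟩
      infer_instance
    -- The summand is a nonzero constant on subgroups of index `m`, so convergence itself forces
    -- their number to be finite.
    · have h1 : Summable fun N : {N // Φ N = m} => (m : ℂ) ^ (-s) := by
        have := hs.summable.comp_injective (Subtype.val_injective (p := fun N => Φ N = m))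
        refine this.congr fun N => ?_
        have := N.2
        simp only [hΦ] at this
        simp [this]
      exact finite_of_summable_const (by simp [Complex.cpow_eq_zero_iff, hm]) h1
  refine ⟨fun m hm => ?_, ?_⟩
  · obtain ⟨e⟩ := hequiv m hm.ne'
    have : Finite (openNormalSubgroups G m) := Finite.of_equiv _ e
    exact Set.toFinite _
  · have h1 := ((Equiv.sigmaFiberEquiv Φ).hasSum_iff.2 hs).sigma
      (g := fun m => LSeries.term (normalCount G) s m) (fun m => ?_)
    · exact h1
    · have : Fintype {N // Φ N = m} := Fintype.ofFinite _
      convert hasSum_fintype _ using 1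
      rcases eq_or_ne m 0 with rfl | hm
      · have : IsEmpty {N // Φ N = 0} := ⟨fun N => N.1.2.2 N.2⟩
        simp
      · have h2 : ∀ N : {N // Φ N = m}, (((fun N : {N : Subgroup G // N.Normal ∧ N.index ≠ 0} =>
            (N.1.index : ℂ) ^ (-s)) ∘ Equiv.sigmaFiberEquiv Φ) ⟨m, N⟩) = (m : ℂ) ^ (-s) := by
          intro N
          have := N.2
          simp only [hΦ] at this
          simp [Equiv.sigmaFiberEquiv, this]
        obtain ⟨e⟩ := hequiv m hm
        rw [Finset.sum_congr rfl fun N _ => h2 N, Finset.sum_const, LSeries.term_of_ne_zero hm,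
          normalCount, Complex.cpow_neg, nsmul_eq_mul, div_eq_mul_inv,
          ← Nat.card_coe_set_eq, ← Nat.card_congr e, Nat.card_eq_fintype_card, Finset.card_univ]

end NormalZeta

/-! ### Finite-index subgroups and homomorphisms over `ℤ_[p]`. -/

section PadicModules

variable {p : ℕ} [Fact p.Prime]

theorem PadicInt.exists_natCast_dvd_sub {m : ℕ} (hm : m ≠ 0) (a : ℤ_[p]) :
    ∃ k : ℕ, (m : ℤ_[p]) ∣ a - k := by
  have hm' : (m : ℤ_[p]) ≠ 0 := by exact_mod_cast hm
  refine ⟨a.appr (m : ℤ_[p]).valuation, ?_⟩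
  have := PadicInt.appr_spec (m : ℤ_[p]).valuation a
  rw [Ideal.mem_span_singleton] at this
  refine dvd_trans ?_ this
  rw [PadicInt.unitCoeff_spec hm']
  refine (Units.mul_left_dvd).2 ?_
  rw [← PadicInt.unitCoeff_spec hm']

/-- Modulo the index a `p`-adic scalar is a natural number, so no continuity assumption is needed
for additive subgroups to be submodules. -/
theorem AddSubgroup.padic_smul_mem {V : Type*} [AddCommGroup V] [Module ℤ_[p] V]
    {L : AddSubgroup V} (hL : L.index ≠ 0) (a : ℤ_[p]) {x : V} (hx : x ∈ L) : a • x ∈ L := by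
  obtain ⟨k, c, hc⟩ := PadicInt.exists_natCast_dvd_sub hL a
  rw [sub_eq_iff_eq_add] at hc
  rw [hc, add_smul, mul_smul, Nat.cast_smul_eq_nsmul, Nat.cast_smul_eq_nsmul]
  exact L.add_mem (L.nsmul_index_mem _) (L.nsmul_mem hx k)

/-- An additive subgroup of finite index of a `ℤ_[p]`-module, as a submodule. -/
def AddSubgroup.toPadicSubmodule (p : ℕ) [Fact p.Prime] {V : Type*} [AddCommGroup V]
    [Module ℤ_[p] V]
    (L : AddSubgroup V) (hL : L.index ≠ 0) : Submodule ℤ_[p] V :=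
  { L with smul_mem' := fun a _ hx => L.padic_smul_mem hL a hx }

theorem map_padic_smul_of_finite {L A : Type*} [AddCommGroup L] [Module ℤ_[p] L] [AddCommGroup A]
    [Module ℤ_[p] A] [Finite A] (f : L →+ A) (a : ℤ_[p]) (x : L) : f (a • x) = a • f x := by
  obtain ⟨k, c, hc⟩ := PadicInt.exists_natCast_dvd_sub (Nat.card_pos (α := A)).ne' a
  rw [sub_eq_iff_eq_add] at hc
  rw [hc, add_smul, mul_smul, add_smul, mul_smul, Nat.cast_smul_eq_nsmul, Nat.cast_smul_eq_nsmul,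
    Nat.cast_smul_eq_nsmul, Nat.cast_smul_eq_nsmul, map_add, map_nsmul, map_nsmul,
    card_nsmul_eq_zero', card_nsmul_eq_zero']

/-- Additive maps into a finite module are automatically `ℤ_[p]`-linear, hence given by arbitrary
images of a basis. -/
theorem card_addMonoidHom_of_free {L A : Type*} [AddCommGroup L] [Module ℤ_[p] L]
    [Module.Free ℤ_[p] L] [Module.Finite ℤ_[p] L] [AddCommGroup A] [Module ℤ_[p] A] [Finite A] :
    Finite (L →+ A) ∧ Nat.card (L →+ A) = Nat.card A ^ Module.finrank ℤ_[p] L := by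
  let e : (L →+ A) ≃ (L →ₗ[ℤ_[p]] A) :=
    ⟨fun f => { f with map_smul' := fun a x => map_padic_smul_of_finite f a x },
      fun f => f.toAddMonoidHom, fun _ => rfl, fun _ => rfl⟩
  let e' := e.trans ((Module.finBasis ℤ_[p] L).constr ℕ).symm.toEquiv
  refine ⟨Finite.of_equiv _ e'.symm, ?_⟩
  rw [Nat.card_congr e', Nat.card_fun]
  simp

/-- Multiplication by the index embeds `V` into `L`. -/
theorem finrank_toPadicSubmodule {V : Type*} [AddCommGroup V] [Module ℤ_[p] V]
    [Module.Free ℤ_[p] V] [Module.Finite ℤ_[p] V] (L : AddSubgroup V) (hL : L.index ≠ 0) :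
    Module.finrank ℤ_[p] (L.toPadicSubmodule p hL) = Module.finrank ℤ_[p] V := by
  apply le_antisymm (Submodule.finrank_le _)
  let f : V →ₗ[ℤ_[p]] L.toPadicSubmodule p hL :=
    (LinearMap.lsmul ℤ_[p] V (L.index : ℤ_[p])).codRestrict _ fun x => by
      rw [LinearMap.lsmul_apply, Nat.cast_smul_eq_nsmul]
      exact L.nsmul_index_mem x
  apply LinearMap.finrank_le_finrank_of_injective (f := f)
  intro x y hxy
  have h1 : (L.index : ℤ_[p]) • x = (L.index : ℤ_[p]) • y := congrArg Subtype.val hxy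
  exact smul_right_injective V (by exact_mod_cast hL : (L.index : ℤ_[p]) ≠ 0) h1

theorem card_addMonoidHom_quotient {V W : Type*} [AddCommGroup V] [Module ℤ_[p] V]
    [Module.Free ℤ_[p] V] [Module.Finite ℤ_[p] V] [AddCommGroup W] [Module ℤ_[p] W]
    (L : AddSubgroup V) (hL : L.index ≠ 0) (M : AddSubgroup W) (hM : M.index ≠ 0) :
    Finite (L →+ W ⧸ M) ∧ Nat.card (L →+ W ⧸ M) = M.index ^ Module.finrank ℤ_[p] V := by
  have hfin : Finite (W ⧸ M) := (AddSubgroup.fintypeOfIndexNeZero hM).finite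
  have : Finite (W ⧸ M.toPadicSubmodule p hM) := hfin
  have := card_addMonoidHom_of_free (p := p) (L := L.toPadicSubmodule p hL)
    (A := W ⧸ M.toPadicSubmodule p hM)
  rw [finrank_toPadicSubmodule] at this
  exact this

/-- The index of an additive subgroup of a product. -/
theorem AddSubgroup.index_map_fst_mul_index_comap_inr {V W : Type*} [AddCommGroup V]
    [AddCommGroup W] (L : AddSubgroup (V × W)) :
    (L.map (AddMonoidHom.fst V W)).index * (L.comap (AddMonoidHom.inr V W)).index = L.index := by
  have hsurj : Function.Surjective (AddMonoidHom.fst V W) := Prod.fst_surjective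
  rw [AddSubgroup.index_map, AddMonoidHom.range_eq_top_of_surjective _ hsurj,
    AddSubgroup.index_top, mul_one, AddSubgroup.index_comap, ← AddSubgroup.relIndex_mul_index
      (le_sup_left : L ≤ L ⊔ (AddMonoidHom.fst V W).ker), mul_comm]
  congr 1
  have hker : (AddMonoidHom.inr V W).range = (AddMonoidHom.fst V W).ker := by
    ext ⟨v, w⟩
    rw [AddMonoidHom.mem_ker, AddMonoidHom.mem_range]
    simp [eq_comm]
  rw [hker, AddSubgroup.relIndex_sup_left]

end PadicModules

/-! ### Convergence of the lattice sum for `ℤ_[p] ^ d`. -/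

section PadicLattices

variable {p : ℕ} [Fact p.Prime]

theorem natCast_pow_cpow (p k : ℕ) (z : ℂ) : ((p ^ k : ℕ) : ℂ) ^ z = ((p : ℂ) ^ z) ^ k := by
  induction k with
  | zero => simp
  | succ k ih => rw [pow_succ, Nat.cast_mul, Complex.natCast_mul_natCast_cpow, ih, pow_succ]

theorem norm_prime_cpow_lt_one {z : ℂ} (hz : z.re < 0) : ‖(p : ℂ) ^ z‖ < 1 := by
  have hp := (Fact.out : p.Prime)
  rw [Complex.norm_natCast_cpow_of_pos hp.pos]
  exact Real.rpow_lt_one_of_one_lt_of_neg (by exact_mod_cast hp.one_lt) hz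

theorem PadicInt.isTotallyRamifiedAt : IsTotallyRamifiedAt p 1 (p : ℤ_[p]) where
  prime := Fact.out
  irreducible := PadicInt.irreducible_p
  pos := one_pos
  addVal_prime := by
    rw [IsDiscreteValuationRing.addVal_uniformizer PadicInt.irreducible_p, Nat.cast_one]
  exists_digit x := by
    obtain ⟨c, hc, hx⟩ := PadicInt.exists_mem_range x
    rw [PadicInt.maximalIdeal_eq_span_p, Ideal.mem_span_singleton] at hx
    exact ⟨c, hc, hx⟩

theorem summable_index_padicInt {s : ℂ} (hs : 0 < s.re) :
    Summable fun I : {I : AddSubgroup ℤ_[p] // I.index ≠ 0} => (I.1.index : ℂ) ^ (-s) := by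
  -- The general lattice sum with `R = ℤ_[p]` and ramification index one; `Y = 1` ignores the
  -- conductor.
  have h := (PadicInt.isTotallyRamifiedAt (p := p)).hasSum_lattice (N := 0) (X := (p : ℂ) ^ (-s))
    (Y := 1) one_ne_zero (φ := fun m => (m : ℂ) ^ (-s)) (natCast_pow_cpow p · _) (fun _ => 0)
    (fun k => k.elim0) (fun k => k.elim0) (by
      rw [mul_one]
      exact norm_prime_cpow_lt_one (by simpa using hs))
  simpa using h.summable

/-- Additive equivalences preserve the additive subgroups of finite index. -/
def AddEquiv.finiteIndexEquiv {V W : Type*} [AddGroup V] [AddGroup W] (e : V ≃+ W) :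
    {L : AddSubgroup V // L.index ≠ 0} ≃ {L : AddSubgroup W // L.index ≠ 0} :=
  e.mapAddSubgroup.toEquiv.subtypeEquiv fun L => by
    have : (e.mapAddSubgroup L).index = L.index := AddSubgroup.index_map_equiv L e
    exact not_congr (by rw [← this]; rfl)

theorem AddEquiv.index_finiteIndexEquiv {V W : Type*} [AddGroup V] [AddGroup W] (e : V ≃+ W)
    (L : {L : AddSubgroup V // L.index ≠ 0}) : (e.finiteIndexEquiv L).1.index = L.1.index :=
  AddSubgroup.index_map_equiv L.1 e

theorem AddSubgroup.exists_generator_padicInt (I : AddSubgroup ℤ_[p]) (hI : I.index ≠ 0) :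
    ∃ a ∈ I, ∀ x ∈ I, ∃ c : ℤ_[p], x = c * a := by
  obtain ⟨a, ha⟩ := IsPrincipalIdealRing.principal (I.toPadicSubmodule p hI)
  have hmem : ∀ x, x ∈ I ↔ x ∈ Submodule.span ℤ_[p] {a} := fun x => by rw [← ha]; rfl
  refine ⟨a, (hmem a).2 (Submodule.mem_span_singleton_self a), fun x hx => ?_⟩
  obtain ⟨c, hc⟩ := Submodule.mem_span_singleton.1 ((hmem x).1 hx)
  exact ⟨c, hc.symm⟩

/-- A lattice is determined by its projection `I` to `ℤ_[p]`, its intersection `L'` with `W`, and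
the class modulo `L'` of a lift of a generator of `I`. The `[W : L']` possible classes account for
the shift from `s` to `s - 1`. -/
theorem summable_index_prod {W : Type*} [AddCommGroup W] [Module ℤ_[p] W] {s : ℂ} (hs : 0 < s.re)
    (hW : Summable fun L : {L : AddSubgroup W // L.index ≠ 0} => (L.1.index : ℂ) ^ (-(s - 1))) :
    Summable fun L : {L : AddSubgroup (ℤ_[p] × W) // L.index ≠ 0} => (L.1.index : ℂ) ^ (-s) := by
  set F : {I : AddSubgroup ℤ_[p] // I.index ≠ 0} × {L : AddSubgroup W // L.index ≠ 0} → Type _ :=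
    fun q => W ⧸ q.2.1 with hF
  have hfin : ∀ q, Finite (F q) := fun q => (AddSubgroup.fintypeOfIndexNeZero q.2.2).finite
  set g : {I : AddSubgroup ℤ_[p] // I.index ≠ 0} × {L : AddSubgroup W // L.index ≠ 0} → ℂ :=
    fun q => ((q.1.1.index * q.2.1.index : ℕ) : ℂ) ^ (-s) with hg
  have hsum : Summable fun a : Σ q, F q => g a.1 := by
    refine (hasSum_sigma_of_finite (F := F) (g := g)
      (a := (∑' I : {I : AddSubgroup ℤ_[p] // I.index ≠ 0}, (I.1.index : ℂ) ^ (-s)) *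
        ∑' L : {L : AddSubgroup W // L.index ≠ 0}, (L.1.index : ℂ) ^ (-(s - 1))) ?_).summable
    convert hasSum_mul_prod (summable_index_padicInt (p := p) hs).hasSum hW.hasSum using 1
    funext q
    have hne : (q.2.1.index : ℂ) ≠ 0 := by exact_mod_cast q.2.2
    have : Nat.card (F q) = q.2.1.index := rfl
    simp only [hg]
    rw [this, Nat.cast_mul, Complex.natCast_mul_natCast_cpow,
      show -(s - 1) = 1 + -s by ring, Complex.cpow_add _ _ hne, Complex.cpow_one]
    ring
  choose gen hgen hgen' using fun I : {I : AddSubgroup ℤ_[p] // I.index ≠ 0} =>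
    I.1.exists_generator_padicInt I.2
  have hidx := fun L : {L : AddSubgroup (ℤ_[p] × W) // L.index ≠ 0} =>
    L.1.index_map_fst_mul_index_comap_inr
  have hex : ∀ L : {L : AddSubgroup (ℤ_[p] × W) // L.index ≠ 0}, ∃ a : Σ q, F q,
      a.1.1.1 = L.1.map (AddMonoidHom.fst ℤ_[p] W) ∧
        a.1.2.1 = L.1.comap (AddMonoidHom.inr ℤ_[p] W) ∧
        ∃ w, (gen a.1.1, w) ∈ L.1 ∧ QuotientAddGroup.mk w = a.2 := by
    intro L
    have h1 := L.2
    rw [← hidx L] at h1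
    obtain ⟨⟨x, w⟩, hx, hxg⟩ := hgen ⟨_, left_ne_zero_of_mul h1⟩
    exact ⟨⟨(⟨_, left_ne_zero_of_mul h1⟩, ⟨_, right_ne_zero_of_mul h1⟩), QuotientAddGroup.mk w⟩,
      rfl, rfl, w, by rw [← hxg]; exact hx, rfl⟩
  choose j hj1 hj2 w hw hw' using hex
  have hle : ∀ L L', j L = j L' → L.1 ≤ L'.1 := by
    rintro L L' heq ⟨x, y⟩ hxy
    have hxI : x ∈ (j L).1.1.1 := by rw [hj1]; exact ⟨_, hxy, rfl⟩
    obtain ⟨c, hc⟩ := hgen' _ x hxI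
    have h1 : c • (gen (j L).1.1, w L) ∈ L.1 := L.1.padic_smul_mem L.2 c (hw L)
    have h2 : y - c • w L ∈ L.1.comap (AddMonoidHom.inr ℤ_[p] W) := by
      have := L.1.sub_mem hxy h1
      rw [AddSubgroup.mem_comap, AddMonoidHom.inr_apply]
      convert this using 1
      ext <;> simp [hc]
    rw [← hj2, heq, hj2, AddSubgroup.mem_comap, AddMonoidHom.inr_apply] at h2
    have h3 : (gen (j L).1.1, w L) ∈ L'.1 := by
      have h4 : (QuotientAddGroup.mk (w L) : F (j L').1) = QuotientAddGroup.mk (w L') := by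
        rw [hw']
        have := hw' L
        revert this
        rw [heq]
        exact id
      rw [eq_comm, QuotientAddGroup.eq, hj2, AddSubgroup.mem_comap, AddMonoidHom.inr_apply] at h4
      have := L'.1.add_mem (hw L') h4
      rw [← heq] at this
      convert this using 1
      ext <;> simp
    have := L'.1.add_mem (L'.1.padic_smul_mem L'.2 c h3) h2
    convert this using 1
    ext <;> simp [hc]
  have hinj : Function.Injective j := fun L L' h =>
    Subtype.ext (le_antisymm (hle L L' h) (hle L' L h.symm))
  refine (hsum.comp_injective hinj).congr fun L => ?_
  simp only [Function.comp_apply, hg]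
  rw [hj1, hj2, hidx]

theorem summable_index_pi (d : ℕ) {s : ℂ} (hs : (d : ℝ) - 1 < s.re) :
    Summable fun L : {L : AddSubgroup (Fin d → ℤ_[p]) // L.index ≠ 0} =>
      (L.1.index : ℂ) ^ (-s) := by
  induction d generalizing s with
  | zero =>
    have : Finite {L : AddSubgroup (Fin 0 → ℤ_[p]) // L.index ≠ 0} := inferInstance
    have := Fintype.ofFinite {L : AddSubgroup (Fin 0 → ℤ_[p]) // L.index ≠ 0}
    exact (hasSum_fintype _).summable
  | succ d ih =>
    push_cast at hs
    have h1 := summable_index_prod (p := p) (W := Fin d → ℤ_[p]) (s := s)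
      (by have : (0 : ℝ) ≤ d := Nat.cast_nonneg d
          linarith)
      (ih (by rw [Complex.sub_re, Complex.one_re]; linarith))
    let e : (ℤ_[p] × (Fin d → ℤ_[p])) ≃+ (Fin (d + 1) → ℤ_[p]) :=
      (Fin.consLinearEquiv ℤ_[p] (fun _ => ℤ_[p])).toAddEquiv
    rw [← e.finiteIndexEquiv.summable_iff]
    refine h1.congr fun L => ?_
    rw [Function.comp_apply, e.index_finiteIndexEquiv]

end PadicLattices

/-! ### Residue degree one yields digits and the valuation of `p`. -/

section TotallyRamified

/-- Digits come from the residue field being one-dimensional over `𝔽_p`. The valuation `v` of `p`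
equals `n` because `R / pR` has order `p ^ v` by counting gaps and `p ^ n` by freeness of rank `n`.
-/
theorem isTotallyRamifiedAt_of_inertiaDeg_eq_one {p : ℕ} [Fact p.Prime] {n : ℕ}
    {R : Type*} [CommRing R] [IsDomain R] [IsDiscreteValuationRing R] [CharZero R]
    [Algebra ℤ_[p] R] [Module.Finite ℤ_[p] R] [Module.Free ℤ_[p] R]
    (hdeg : Module.finrank ℤ_[p] R = n)
    (hram : (IsLocalRing.maximalIdeal R).inertiaDeg ℤ_[p] = 1) {π : R} (hπ : Irreducible π) :
    IsTotallyRamifiedAt p n π := by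
  have hp : p.Prime := Fact.out
  set q := (IsLocalRing.maximalIdeal R).under ℤ_[p] with hq
  have hqmax : q.IsMaximal := Ideal.isMaximal_comap_of_isIntegral_of_isMaximal _
  have hqeq : q = IsLocalRing.maximalIdeal ℤ_[p] := IsLocalRing.eq_maximalIdeal hqmax
  have hpm : (p : R) ∈ IsLocalRing.maximalIdeal R := by
    have : (p : ℤ_[p]) ∈ q := by
      rw [hqeq, PadicInt.maximalIdeal_eq_span_p]
      exact Ideal.mem_span_singleton_self _
    have h2 := Ideal.mem_comap.1 this
    simpa using h2
  have hdvd : π ∣ (p : R) := by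
    rwa [hπ.maximalIdeal_eq, Ideal.mem_span_singleton] at hpm
  rw [Ideal.inertiaDeg_eq_of_isMaximal q] at hram
  have hdigit : ∀ x : R, ∃ c < p, π ∣ x - (c : R) := by
    intro x
    have h1 : ∃ a : ℤ_[p], x - algebraMap ℤ_[p] R a ∈ IsLocalRing.maximalIdeal R := by
      let : Field (ℤ_[p] ⧸ q) := Ideal.Quotient.field q
      obtain ⟨a, ha⟩ := (finrank_eq_one_iff_of_nonzero' (K := ℤ_[p] ⧸ q)
        (1 : R ⧸ IsLocalRing.maximalIdeal R) one_ne_zero).1 hram (Ideal.Quotient.mk _ x)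
      obtain ⟨a, rfl⟩ := Ideal.Quotient.mk_surjective a
      refine ⟨a, ?_⟩
      rw [← Ideal.Quotient.eq, ← ha, Algebra.smul_def, mul_one]
      rfl
    obtain ⟨a, ha⟩ := h1
    obtain ⟨c, hc, hac⟩ := PadicInt.exists_mem_range a
    refine ⟨c, hc, ?_⟩
    rw [← hqeq] at hac
    have h2 : algebraMap ℤ_[p] R (a - c) ∈ IsLocalRing.maximalIdeal R := Ideal.mem_comap.1 hac
    rw [map_sub, map_natCast] at h2
    have h3 := Ideal.add_mem _ ha h2
    rw [sub_add_sub_cancel] at h3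
    rwa [hπ.maximalIdeal_eq, Ideal.mem_span_singleton] at h3
  have hp0 : (p : R) ≠ 0 := by exact_mod_cast hp.ne_zero
  obtain ⟨v, hv⟩ := ENat.ne_top_iff_exists.1
    (fun h => hp0 ((IsDiscreteValuationRing.addVal_eq_top_iff).1 h) :
      IsDiscreteValuationRing.addVal R (p : R) ≠ ⊤)
  have hvpos : 0 < v := by
    have := hπ.le_addVal_iff (k := 1) (x := (p : R))
    rw [pow_one, ← hv] at this
    exact_mod_cast this.2 hdvd
  have h : IsTotallyRamifiedAt p v π := ⟨hp, hπ, hvpos, hv.symm, hdigit⟩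
  suffices hvn : p ^ v = p ^ n by
    rwa [Nat.pow_right_injective hp.two_le hvn] at h
  have hmem : ∀ x, x ∈ (Ideal.span {(p : R)}).toAddSubgroup ↔ π ^ v ∣ x := by
    intro x
    rw [← h.irreducible.le_addVal_iff, hv, IsDiscreteValuationRing.addVal_le_iff_dvd]
    exact Ideal.mem_span_singleton
  have hset : ∀ g, g ∈ Finset.range v ↔ g ∉ valueSet (Ideal.span {(p : R)}).toAddSubgroup := by
    intro g
    rw [Finset.mem_range, ← not_le, not_iff_not]
    constructor
    · exact fun hg => ⟨π ^ g, (hmem _).2 (pow_dvd_pow _ hg), h.addVal_uniformizer_pow g⟩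
    · rintro ⟨x, hx, hxg⟩
      rw [hmem, ← h.irreducible.le_addVal_iff, hxg] at hx
      exact_mod_cast hx
  have h1 := h.index_eq ⟨v, fun x hx => (hmem x).2 hx⟩ hset
  rw [Finset.card_range] at h1
  rw [← h1]
  let b := (Module.finBasisOfFinrankEq ℤ_[p] R hdeg).equivFun
  let ψ : R →+ (Fin n → ZMod p) :=
    (AddMonoidHom.compLeft (PadicInt.toZMod (p := p)).toAddMonoidHom (Fin n)).comp
      b.toLinearMap.toAddMonoidHom
  have hker : (Ideal.span {(p : R)}).toAddSubgroup = ψ.ker := by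
    ext x
    have h2 : x ∈ ψ.ker ↔ ∀ i, PadicInt.toZMod (b x i) = 0 := by
      rw [AddMonoidHom.mem_ker]
      exact funext_iff
    have h3 : ∀ y : ℤ_[p], PadicInt.toZMod y = 0 ↔ (p : ℤ_[p]) ∣ y := by
      intro y
      rw [← RingHom.mem_ker, PadicInt.ker_toZMod, PadicInt.maximalIdeal_eq_span_p,
        Ideal.mem_span_singleton]
    rw [h2]
    simp only [h3]
    change x ∈ Ideal.span {(p : R)} ↔ _
    rw [Ideal.mem_span_singleton]
    have hps : ∀ y : R, (p : R) * y = (p : ℤ_[p]) • y := fun y => by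
      rw [Algebra.smul_def, map_natCast]
    constructor
    · rintro ⟨y, rfl⟩ i
      rw [hps, map_smul]
      exact ⟨b y i, rfl⟩
    · intro hx
      choose y hy using hx
      refine ⟨b.symm y, b.injective ?_⟩
      rw [hps, map_smul, LinearEquiv.apply_symm_apply]
      exact funext hy
  have hsurj : Function.Surjective ψ := by
    intro y
    choose z hz using fun i => ZMod.ringHom_surjective (PadicInt.toZMod (p := p)) (y i)
    refine ⟨b.symm z, ?_⟩
    funext i
    change PadicInt.toZMod (b (b.symm z) i) = y i
    rw [LinearEquiv.apply_symm_apply, hz]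
  rw [hker, AddSubgroup.index_ker, AddMonoidHom.range_eq_top_of_surjective _ hsurj]
  simp [Nat.card_eq_fintype_card, ZMod.card]

end TotallyRamified

/-! ### Normal subgroups of the Heisenberg group. -/

namespace heisenbergGroup

variable {R : Type*} [CommRing R]

/-- The `(1, 2)` entry. -/
def x (A : heisenbergGroup R) : R := (A : Matrix.SpecialLinearGroup (Fin 3) R).1 0 1

/-- The `(2, 3)` entry. -/
def y (A : heisenbergGroup R) : R := (A : Matrix.SpecialLinearGroup (Fin 3) R).1 1 2

/-- The `(1, 3)` entry. -/
def z (A : heisenbergGroup R) : R := (A : Matrix.SpecialLinearGroup (Fin 3) R).1 0 2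

/-- The element with given entries above the diagonal. -/
def mk (a b c : R) : heisenbergGroup R :=
  ⟨⟨!![1, a, c; 0, 1, b; 0, 0, 1], by simp [Matrix.det_fin_three]⟩, by
    refine ⟨fun i => ?_, fun i j h => ?_⟩
    · fin_cases i <;> rfl
    · fin_cases i <;> fin_cases j <;> first | rfl | simp at h⟩

@[simp] theorem x_mk (a b c : R) : x (mk a b c) = a := rfl

@[simp] theorem y_mk (a b c : R) : y (mk a b c) = b := rfl

@[simp] theorem z_mk (a b c : R) : z (mk a b c) = c := rfl

theorem ext {A B : heisenbergGroup R} (hx : x A = x B) (hy : y A = y B) (hz : z A = z B) :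
    A = B := by
  obtain ⟨A, hA1, hA2⟩ := A
  obtain ⟨B, hB1, hB2⟩ := B
  apply Subtype.ext
  apply Matrix.SpecialLinearGroup.ext
  intro i j
  change A 0 1 = B 0 1 at hx
  change A 1 2 = B 1 2 at hy
  change A 0 2 = B 0 2 at hz
  change A i j = B i j
  rcases lt_trichotomy i j with h | rfl | h
  · fin_cases i <;> fin_cases j <;> first | assumption | simp at h
  · rw [hA1, hB1]
  · rw [hA2 i j h, hB2 i j h]

@[simp] theorem x_mul (A B : heisenbergGroup R) : x (A * B) = x A + x B := by
  obtain ⟨A, hA1, hA2⟩ := A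
  obtain ⟨B, hB1, hB2⟩ := B
  change (A * B) 0 1 = A 0 1 + B 0 1
  simp [Matrix.SpecialLinearGroup.coe_mul, Matrix.mul_apply, Fin.sum_univ_three, hA1, hB1,
    hB2 2 1, add_comm]

@[simp] theorem y_mul (A B : heisenbergGroup R) : y (A * B) = y A + y B := by
  obtain ⟨A, hA1, hA2⟩ := A
  obtain ⟨B, hB1, hB2⟩ := B
  change (A * B) 1 2 = A 1 2 + B 1 2
  simp [Matrix.SpecialLinearGroup.coe_mul, Matrix.mul_apply, Fin.sum_univ_three, hA1, hB1,
    hA2 1 0, add_comm]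

@[simp] theorem z_mul (A B : heisenbergGroup R) : z (A * B) = z A + z B + x A * y B := by
  obtain ⟨A, hA1, hA2⟩ := A
  obtain ⟨B, hB1, hB2⟩ := B
  change (A * B) 0 2 = A 0 2 + B 0 2 + A 0 1 * B 1 2
  simp [Matrix.SpecialLinearGroup.coe_mul, Matrix.mul_apply, Fin.sum_univ_three, hA1, hB1]
  ring

@[simp] theorem x_one : x (1 : heisenbergGroup R) = 0 := by
  simpa using x_mul (1 : heisenbergGroup R) 1

@[simp] theorem y_one : y (1 : heisenbergGroup R) = 0 := by
  simpa using y_mul (1 : heisenbergGroup R) 1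

@[simp] theorem z_one : z (1 : heisenbergGroup R) = 0 := by
  simpa using z_mul (1 : heisenbergGroup R) 1

@[simp] theorem x_inv (A : heisenbergGroup R) : x A⁻¹ = - x A := by
  have := x_mul A A⁻¹
  rw [mul_inv_cancel, x_one] at this
  linear_combination -this

@[simp] theorem y_inv (A : heisenbergGroup R) : y A⁻¹ = - y A := by
  have := y_mul A A⁻¹
  rw [mul_inv_cancel, y_one] at this
  linear_combination -this

@[simp] theorem z_inv (A : heisenbergGroup R) : z A⁻¹ = - z A + x A * y A := by
  have := z_mul A A⁻¹
  rw [mul_inv_cancel, z_one, y_inv] at this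
  linear_combination -this

/-- The projection to the abelianisation. -/
def proj (R : Type*) [CommRing R] : heisenbergGroup R →* Multiplicative (R × R) where
  toFun A := Multiplicative.ofAdd (x A, y A)
  map_one' := by rw [x_one, y_one]; rfl
  map_mul' A B := by rw [x_mul, y_mul]; rfl

/-- The one-parameter subgroup of the `(1, 2)` entry. -/
def xHom (R : Type*) [CommRing R] : Multiplicative R →* heisenbergGroup R where
  toFun a := mk a.toAdd 0 0
  map_one' := ext (by simp) (by simp) (by simp)
  map_mul' a b := ext (by simp) (by simp) (by simp)

/-- The one-parameter subgroup of the `(2, 3)` entry. -/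
def yHom (R : Type*) [CommRing R] : Multiplicative R →* heisenbergGroup R where
  toFun a := mk 0 a.toAdd 0
  map_one' := ext (by simp) (by simp) (by simp)
  map_mul' a b := ext (by simp) (by simp) (by simp)

/-- The inclusion of the centre. -/
def zHom (R : Type*) [CommRing R] : Multiplicative R →* heisenbergGroup R where
  toFun a := mk 0 0 a.toAdd
  map_one' := ext (by simp) (by simp) (by simp)
  map_mul' a b := ext (by simp) (by simp) (by simp)

theorem proj_surjective : Function.Surjective (proj R) := fun v =>
  ⟨mk v.toAdd.1 v.toAdd.2 0, rfl⟩

theorem index_map_proj_mul_index_comap_zHom {N : Subgroup (heisenbergGroup R)} (hN : N.Normal) :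
    (N.map (proj R)).index * (N.comap (zHom R)).index = N.index := by
  rw [Subgroup.index_map, MonoidHom.range_eq_top_of_surjective _ proj_surjective,
    Subgroup.index_top, mul_one, Subgroup.index_comap, ← Subgroup.relIndex_mul_index
      (le_sup_left : N ≤ N ⊔ (proj R).ker), mul_comm]
  congr 1
  have hker : (zHom R).range = (proj R).ker := by
    ext A
    rw [MonoidHom.mem_ker, MonoidHom.mem_range]
    constructor
    · rintro ⟨a, rfl⟩
      rfl
    · intro hA
      have hA' : (x A, y A) = (0, 0) := hA
      rw [Prod.mk.injEq] at hA'
      exact ⟨Multiplicative.ofAdd (z A), ext hA'.1.symm hA'.2.symm rfl⟩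
  rw [hker, Subgroup.relIndex_sup_left]

/-- The index power of any element lies in `N`; applied to the three one-parameter subgroups, this
puts a whole congruence subgroup inside `N`. -/
theorem mem_of_dvd {N : Subgroup (heisenbergGroup R)} (hN : N.Normal) {A : heisenbergGroup R}
    (hx : (N.index : R) ∣ x A) (hy : (N.index : R) ∣ y A) (hz : (N.index : R) ∣ z A) : A ∈ N := by
  obtain ⟨a, ha⟩ := hx
  obtain ⟨b, hb⟩ := hy
  obtain ⟨c, hc⟩ := hz
  set m := N.index with hm
  have h1 : mk (m * a) 0 0 ∈ N := by
    have := N.pow_index_mem (xHom R (Multiplicative.ofAdd a))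
    rw [← map_pow, ← ofAdd_nsmul, nsmul_eq_mul] at this
    exact this
  have h2 : mk 0 (m * b) 0 ∈ N := by
    have := N.pow_index_mem (yHom R (Multiplicative.ofAdd b))
    rw [← map_pow, ← ofAdd_nsmul, nsmul_eq_mul] at this
    exact this
  -- The correction cancels the cocycle term produced by multiplying the other two factors.
  have h3 : mk 0 0 (m * (c - m * a * b)) ∈ N := by
    have := N.pow_index_mem (zHom R (Multiplicative.ofAdd (c - m * a * b)))
    rw [← map_pow, ← ofAdd_nsmul, nsmul_eq_mul] at this
    exact this
  have : A = mk (m * a) 0 0 * mk 0 (m * b) 0 * mk 0 0 (m * (c - m * a * b)) := by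
    apply ext
    · simp [ha]
    · simp [hb]
    · simp [hc]
      ring
  rw [this]
  exact N.mul_mem (N.mul_mem h1 h2) h3

/-- The subgroup determined by a lattice `L`, scaled by `c`, and a homomorphism to the quotient by
a lattice `M` in the centre. -/
def subgroupOf (c : R) (L : AddSubgroup (R × R)) (M : AddSubgroup R) (hM : ∀ r, c * r ∈ M)
    (φ : L →+ R ⧸ M) : Subgroup (heisenbergGroup R) where
  carrier := {A | ∃ v : L, x A = c * v.1.1 ∧ y A = c * v.1.2 ∧ φ v = QuotientAddGroup.mk (z A)}
  one_mem' := ⟨0, by simp, by simp, by simp⟩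
  mul_mem' := by
    rintro A B ⟨v, hx, hy, hz⟩ ⟨w, hx', hy', hz'⟩
    refine ⟨v + w, by simp [hx, hx', mul_add], by simp [hy, hy', mul_add], ?_⟩
    rw [map_add, hz, hz', ← QuotientAddGroup.mk_add, QuotientAddGroup.eq, z_mul, hx, mul_assoc]
    -- The cocycle `x A * y B` is a multiple of `c` and so vanishes modulo `M`.
    convert hM (v.1.1 * y B) using 1
    ring
  inv_mem' := by
    rintro A ⟨v, hx, hy, hz⟩
    refine ⟨-v, by simp [hx], by simp [hy], ?_⟩
    rw [map_neg, hz, ← QuotientAddGroup.mk_neg, QuotientAddGroup.eq, z_inv, hx, mul_assoc]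
    convert hM (v.1.1 * y A) using 1
    ring

theorem mem_subgroupOf {c : R} {L : AddSubgroup (R × R)} {M : AddSubgroup R}
    {hM : ∀ r, c * r ∈ M} {φ : L →+ R ⧸ M} {A : heisenbergGroup R} :
    A ∈ subgroupOf c L M hM φ ↔
      ∃ v : L, x A = c * v.1.1 ∧ y A = c * v.1.2 ∧ φ v = QuotientAddGroup.mk (z A) := Iff.rfl

theorem normal_subgroupOf (c : R) (L : AddSubgroup (R × R)) (M : AddSubgroup R)
    (hM : ∀ r, c * r ∈ M) (φ : L →+ R ⧸ M) : (subgroupOf c L M hM φ).Normal := by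
  refine ⟨?_⟩
  rintro A ⟨v, hx, hy, hz⟩ G
  refine ⟨v, by simp [hx], by simp [hy], ?_⟩
  rw [hz, QuotientAddGroup.eq]
  simp only [z_mul, x_mul, z_inv, y_inv, hx, hy]
  convert hM (x G * v.1.2 - v.1.1 * y G) using 1
  ring

theorem mk_zero_zero_mem_subgroupOf [IsDomain R] {c : R} (hc : c ≠ 0) {L : AddSubgroup (R × R)}
    {M : AddSubgroup R} {hM : ∀ r, c * r ∈ M} {φ : L →+ R ⧸ M} {r : R} :
    mk 0 0 r ∈ subgroupOf c L M hM φ ↔ r ∈ M := by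
  rw [mem_subgroupOf]
  constructor
  · rintro ⟨v, hx, hy, hz⟩
    have hv : v = 0 := by
      apply Subtype.ext
      apply Prod.ext
      · simpa [hc] using hx.symm
      · simpa [hc] using hy.symm
    rw [hv, map_zero, eq_comm, z_mk] at hz
    exact (QuotientAddGroup.eq_zero_iff r).1 hz
  · intro hr
    refine ⟨0, by simp, by simp, ?_⟩
    rw [map_zero, z_mk, eq_comm]
    exact (QuotientAddGroup.eq_zero_iff r).2 hr

theorem mk_mem_subgroupOf [IsDomain R] {c : R} (hc : c ≠ 0) {L : AddSubgroup (R × R)}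
    {M : AddSubgroup R} {hM : ∀ r, c * r ∈ M} {φ : L →+ R ⧸ M} {a b r : R} :
    mk (c * a) (c * b) r ∈ subgroupOf c L M hM φ ↔
      ∃ h : (a, b) ∈ L, φ ⟨(a, b), h⟩ = QuotientAddGroup.mk r := by
  rw [mem_subgroupOf]
  constructor
  · rintro ⟨⟨⟨a', b'⟩, hv⟩, hx, hy, hz⟩
    obtain rfl : a = a' := mul_left_cancel₀ hc hx
    obtain rfl : b = b' := mul_left_cancel₀ hc hy
    exact ⟨hv, hz⟩
  · rintro ⟨hv, hz⟩
    exact ⟨⟨(a, b), hv⟩, rfl, rfl, hz⟩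

/-- The image in the abelianisation is `c L` and the central part is `M`; scaling by `c` costs the
index of `c R` once per coordinate. -/
theorem index_subgroupOf [IsDomain R] {c : R} (hc : c ≠ 0) (L : AddSubgroup (R × R))
    (M : AddSubgroup R) (hM : ∀ r, c * r ∈ M) (φ : L →+ R ⧸ M) :
    (subgroupOf c L M hM φ).index =
      L.index * (AddMonoidHom.mulLeft c).range.index ^ 2 * M.index := by
  rw [← index_map_proj_mul_index_comap_zHom (normal_subgroupOf c L M hM φ)]
  congr 1
  · set f : R × R →+ R × R := (AddMonoidHom.mulLeft c).prodMap (AddMonoidHom.mulLeft c) with hf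
    have hinj : Function.Injective f := by
      rintro ⟨a, b⟩ ⟨a', b'⟩ h
      have h' : (c * a, c * b) = (c * a', c * b') := h
      rw [Prod.mk.injEq] at h'
      exact Prod.ext (mul_left_cancel₀ hc h'.1) (mul_left_cancel₀ hc h'.2)
    have hrange : f.range = (AddMonoidHom.mulLeft c).range.prod (AddMonoidHom.mulLeft c).range := by
      ext ⟨a, b⟩
      rw [AddSubgroup.mem_prod, AddMonoidHom.mem_range]
      constructor
      · rintro ⟨⟨a', b'⟩, h⟩
        have h' : (c * a', c * b') = (a, b) := h
        rw [Prod.mk.injEq] at h'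
        exact ⟨⟨a', h'.1⟩, ⟨b', h'.2⟩⟩
      · rintro ⟨⟨a', ha⟩, ⟨b', hb⟩⟩
        exact ⟨(a', b'), Prod.ext ha hb⟩
    have hmap : (subgroupOf c L M hM φ).map (proj R) = AddSubgroup.toSubgroup (L.map f) := by
      ext v
      constructor
      · rintro ⟨A, ⟨w, hx, hy, -⟩, rfl⟩
        exact ⟨w.1, w.2, Prod.ext hx.symm hy.symm⟩
      · rintro ⟨w, hw, hwv⟩
        obtain ⟨r, hr⟩ := QuotientAddGroup.mk_surjective (φ ⟨w, hw⟩)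
        exact ⟨mk (c * w.1) (c * w.2) r, ⟨⟨w, hw⟩, rfl, rfl, hr.symm⟩, hwv⟩
    rw [hmap, AddSubgroup.index_toSubgroup, AddSubgroup.index_map_of_injective _ hinj, hrange,
      AddSubgroup.index_prod, sq]
  · have : (subgroupOf c L M hM φ).comap (zHom R) = AddSubgroup.toSubgroup M := by
      ext r
      exact mk_zero_zero_mem_subgroupOf hc (hM := hM) (φ := φ)
    rw [this, AddSubgroup.index_toSubgroup]

/-- Subgroups given by different data are different. -/
theorem subgroupOf_injective [IsDomain R] {k : AddSubgroup R → R} (hk : ∀ M, k M ≠ 0)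
    {L L' : AddSubgroup (R × R)} {M M' : AddSubgroup R} {hM : ∀ r, k M * r ∈ M}
    {hM' : ∀ r, k M' * r ∈ M'} {φ : L →+ R ⧸ M} {φ' : L' →+ R ⧸ M'}
    (h : subgroupOf (k M) L M hM φ = subgroupOf (k M') L' M' hM' φ') :
    M = M' ∧ L = L' ∧ HEq φ φ' := by
  have hMM : M = M' := by
    ext r
    rw [← mk_zero_zero_mem_subgroupOf (hk M) (hM := hM) (φ := φ), h,
      mk_zero_zero_mem_subgroupOf (hk M')]
  subst hMM
  have key : ∀ a b r, (∃ h : (a, b) ∈ L, φ ⟨(a, b), h⟩ = QuotientAddGroup.mk r) ↔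
      ∃ h : (a, b) ∈ L', φ' ⟨(a, b), h⟩ = QuotientAddGroup.mk r := by
    intro a b r
    rw [← mk_mem_subgroupOf (hk M) (hM := hM), h, mk_mem_subgroupOf (hk M)]
  have hLL : L = L' := by
    ext ⟨a, b⟩
    constructor
    · intro hv
      obtain ⟨r, hr⟩ := QuotientAddGroup.mk_surjective (φ ⟨_, hv⟩)
      exact ((key a b r).1 ⟨hv, hr.symm⟩).1
    · intro hv
      obtain ⟨r, hr⟩ := QuotientAddGroup.mk_surjective (φ' ⟨_, hv⟩)
      exact ((key a b r).2 ⟨hv, hr.symm⟩).1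
  subst hLL
  refine ⟨rfl, rfl, heq_of_eq ?_⟩
  ext ⟨⟨a, b⟩, hv⟩
  obtain ⟨r, hr⟩ := QuotientAddGroup.mk_surjective (φ ⟨_, hv⟩)
  obtain ⟨_, h2⟩ := (key a b r).1 ⟨hv, hr.symm⟩
  rw [h2, hr]

/-- These central elements are commutators of `A` with elementary matrices. -/
theorem mul_mem_of_normal {N : Subgroup (heisenbergGroup R)} (hN : N.Normal)
    {A : heisenbergGroup R} (hA : A ∈ N) (d : R) :
    mk 0 0 (x A * d) ∈ N ∧ mk 0 0 (y A * d) ∈ N := by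
  constructor
  · have h1 := N.mul_mem hA (hN.conj_mem _ (N.inv_mem hA) (mk 0 d 0))
    convert h1 using 1
    apply ext <;> simp
    ring
  · have h1 := N.mul_mem (hN.conj_mem _ hA (mk d 0 0)) (N.inv_mem hA)
    convert h1 using 1
    apply ext <;> simp
    ring

theorem mem_iff_of_eq {N : Subgroup (heisenbergGroup R)} {A B : heisenbergGroup R} (hA : A ∈ N)
    (hx : x A = x B) (hy : y A = y B) : B ∈ N ↔ mk 0 0 (-z A + z B) ∈ N := by
  have : B = mk 0 0 (-z A + z B) * A := by
    apply ext
    · simp [hx]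
    · simp [hy]
    · simp
  conv_lhs => rw [this]
  exact N.mul_mem_cancel_right hA

/-- Every normal subgroup of finite index arises from lattices and a homomorphism. -/
theorem exists_eq_subgroupOf {N : Subgroup (heisenbergGroup R)} (hN : N.Normal)
    (hN' : N.index ≠ 0) : ∃ M : AddSubgroup R, M.index ≠ 0 ∧ (∀ A ∈ N, ∀ d, x A * d ∈ M) ∧
      (∀ A ∈ N, ∀ d, y A * d ∈ M) ∧ ∀ c, ∀ hM : ∀ r, c * r ∈ M, (∀ A ∈ N, c ∣ x A ∧ c ∣ y A) →
        ∃ L : AddSubgroup (R × R), L.index ≠ 0 ∧ ∃ φ : L →+ R ⧸ M, N = subgroupOf c L M hM φ := by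
  have hidx := hN'
  rw [← index_map_proj_mul_index_comap_zHom hN] at hidx
  set M : AddSubgroup R := AddSubgroup.toSubgroup.symm (N.comap (zHom R)) with hMdef
  have hmem : ∀ r, r ∈ M ↔ mk 0 0 r ∈ N := fun r => Iff.rfl
  refine ⟨M, right_ne_zero_of_mul hidx, fun A hA d => (mul_mem_of_normal hN hA d).1,
    fun A hA d => (mul_mem_of_normal hN hA d).2, fun c hM hdvd => ?_⟩
  set P : AddSubgroup (R × R) := AddSubgroup.toSubgroup.symm (N.map (proj R)) with hP
  have hPidx : P.index ≠ 0 := left_ne_zero_of_mul hidx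
  set f : R × R →+ R × R := (AddMonoidHom.mulLeft c).prodMap (AddMonoidHom.mulLeft c) with hf
  have hLmem : ∀ v, v ∈ P.comap f ↔ ∃ A ∈ N, x A = c * v.1 ∧ y A = c * v.2 := by
    intro v
    constructor
    · rintro ⟨A, hA, hAv⟩
      have hAv' : (x A, y A) = (c * v.1, c * v.2) := hAv
      rw [Prod.mk.injEq] at hAv'
      exact ⟨A, hA, hAv'⟩
    · rintro ⟨A, hA, hx, hy⟩
      exact ⟨A, hA, Prod.ext hx hy⟩
  have hLidx : (P.comap f).index ≠ 0 := by
    rw [AddSubgroup.index_comap]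
    exact ne_zero_of_dvd_ne_zero hPidx (AddSubgroup.relIndex_dvd_index_of_normal P f.range)
  choose B hB hBx hBy using fun v : P.comap f => (hLmem v.1).1 v.2
  have huniq : ∀ A ∈ N, ∀ A' ∈ N, x A = x A' → y A = y A' →
      (QuotientAddGroup.mk (z A) : R ⧸ M) = QuotientAddGroup.mk (z A') := by
    intro A hA A' hA' hx hy
    rw [QuotientAddGroup.eq, hmem]
    exact (mem_iff_of_eq hA hx hy).1 hA'
  -- The central coordinate of a lift is well defined modulo `M` by `huniq`, and additive because
  -- the cocycle lies in `c R`.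
  let φ : P.comap f →+ R ⧸ M := AddMonoidHom.mk' (fun v => QuotientAddGroup.mk (z (B v))) (by
    intro v w
    rw [huniq (B (v + w)) (hB _) (B v * B w) (N.mul_mem (hB v) (hB w))
      (by rw [x_mul, hBx, hBx, hBx]; simp [mul_add])
      (by rw [y_mul, hBy, hBy, hBy]; simp [mul_add]), ← QuotientAddGroup.mk_add,
      QuotientAddGroup.eq, z_mul, hBx, mul_assoc]
    convert M.neg_mem (hM (v.1.1 * y (B w))) using 1
    ring)
  refine ⟨P.comap f, hLidx, φ, ?_⟩
  ext A
  rw [mem_subgroupOf]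
  constructor
  · intro hA
    obtain ⟨⟨a, ha⟩, ⟨b, hb⟩⟩ := hdvd A hA
    have hv : (a, b) ∈ P.comap f := (hLmem _).2 ⟨A, hA, ha, hb⟩
    refine ⟨⟨(a, b), hv⟩, ha, hb, ?_⟩
    exact huniq _ (hB _) _ hA (by rw [hBx, ha]) (by rw [hBy, hb])
  · rintro ⟨v, hx, hy, hz⟩
    rw [mem_iff_of_eq (hB v) (by rw [hBx, hx]) (by rw [hBy, hy]), ← hmem]
    exact QuotientAddGroup.eq.1 hz

end heisenbergGroup

namespace heisenbergGroup

/-! ### The zeta sum as a product over pairs of lattices. -/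

section Sum

variable {R : Type*} [CommRing R] [IsDomain R] [IsDiscreteValuationRing R] {p n : ℕ} {π : R}

theorem index_range_mulLeft_pow (h : IsTotallyRamifiedAt p n π) (k : ℕ) :
    (AddMonoidHom.mulLeft (π ^ k)).range.index = p ^ k := by
  have hmem : ∀ x, x ∈ (AddMonoidHom.mulLeft (π ^ k)).range ↔ π ^ k ∣ x := fun x =>
    ⟨fun ⟨y, hy⟩ => ⟨y, hy.symm⟩, fun ⟨y, hy⟩ => ⟨y, hy.symm⟩⟩
  have hset : ∀ g, g ∈ Finset.range k ↔ g ∉ valueSet (AddMonoidHom.mulLeft (π ^ k)).range := by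
    intro g
    rw [Finset.mem_range, ← not_le, not_iff_not]
    constructor
    · exact fun hg => ⟨π ^ g, (hmem _).2 (pow_dvd_pow _ hg), h.addVal_uniformizer_pow g⟩
    · rintro ⟨x, hx, hxg⟩
      rw [hmem, ← h.irreducible.le_addVal_iff, hxg] at hx
      exact_mod_cast hx
  rw [h.index_eq ⟨k, fun x hx => (hmem x).2 hx⟩ hset, Finset.card_range]

theorem _root_.IsTotallyRamifiedAt.latticeConductor_spec [CharZero R]
    (h : IsTotallyRamifiedAt p n π)
    {M : AddSubgroup R} (hM : M.index ≠ 0) (r : R) : π ^ latticeConductor π M * r ∈ M :=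
  Nat.sInf_mem (s := {k | ∀ x, π ^ k ∣ x → x ∈ M}) (h.index_ne_zero_iff.1 hM) _
    (dvd_mul_right _ _)

/-- If `a` is nonzero, `a R` is generated by a power of `π` and lies in `M`, so that power is at
least the conductor. -/
theorem pow_latticeConductor_dvd (h : IsTotallyRamifiedAt p n π) {M : AddSubgroup R} {a : R}
    (ha : ∀ d, a * d ∈ M) : π ^ latticeConductor π M ∣ a := by
  rcases eq_or_ne a 0 with rfl | h0
  · exact dvd_zero _
  · obtain ⟨j, hj⟩ := IsDiscreteValuationRing.associated_pow_irreducible h0 h.irreducible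
    refine (pow_dvd_pow _ (Nat.sInf_le fun x hx => ?_)).trans hj.symm.dvd
    obtain ⟨d, rfl⟩ := hj.dvd.trans hx
    exact ha d

/-- The normal zeta function of the Heisenberg group as a sum over pairs of lattices. -/
theorem hasSum_index_normal [CharZero R] [Fact p.Prime] [Algebra ℤ_[p] R]
    [Module.Finite ℤ_[p] R] [Module.Free ℤ_[p] R] (h : IsTotallyRamifiedAt p n π)
    (hdeg : Module.finrank ℤ_[p] R = n) {s A B : ℂ}
    (hA : HasSum (fun L : {L : AddSubgroup (R × R) // L.index ≠ 0} => (L.1.index : ℂ) ^ (-s)) A)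
    (hB : HasSum (fun M : {M : AddSubgroup R // M.index ≠ 0} =>
      ((M.1.index : ℂ) ^ (2 * n) * (M.1.index : ℂ) ^ (-s)) *
        (((p : ℂ) ^ (-s)) ^ 2) ^ latticeConductor π M.1) B) :
    HasSum (fun N : {N : Subgroup (heisenbergGroup R) // N.Normal ∧ N.index ≠ 0} =>
      (N.1.index : ℂ) ^ (-s)) (A * B) := by
  set F : {L : AddSubgroup (R × R) // L.index ≠ 0} × {M : AddSubgroup R // M.index ≠ 0} → Type _ :=
    fun q => q.1.1 →+ R ⧸ q.2.1 with hF
  have hcard : ∀ q, Finite (F q) ∧ Nat.card (F q) = q.2.1.index ^ (2 * n) := by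
    intro q
    have := card_addMonoidHom_quotient (p := p) q.1.1 q.1.2 q.2.1 q.2.2
    rwa [Module.finrank_prod, hdeg, ← two_mul] at this
  have hfin : ∀ q, Finite (F q) := fun q => (hcard q).1
  have hne : ∀ M : AddSubgroup R, π ^ latticeConductor π M ≠ 0 := fun M =>
    pow_ne_zero _ h.irreducible.ne_zero
  have hindex : ∀ a : Σ q, F q, (subgroupOf (π ^ latticeConductor π a.1.2.1) a.1.1.1 a.1.2.1
      (h.latticeConductor_spec a.1.2.2) a.2).index =
        a.1.1.1.index * (p ^ latticeConductor π a.1.2.1) ^ 2 * a.1.2.1.index := by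
    intro a
    rw [index_subgroupOf (hne _), index_range_mulLeft_pow h]
  let f : (Σ q, F q) → {N : Subgroup (heisenbergGroup R) // N.Normal ∧ N.index ≠ 0} := fun a =>
    ⟨subgroupOf (π ^ latticeConductor π a.1.2.1) a.1.1.1 a.1.2.1
      (h.latticeConductor_spec a.1.2.2) a.2, normal_subgroupOf _ _ _ _ _, by
        rw [hindex]
        exact mul_ne_zero (mul_ne_zero a.1.1.2 (pow_ne_zero _ (pow_ne_zero _ h.prime.ne_zero)))
          a.1.2.2⟩
  have hf : Function.Bijective f := by
    constructor
    · rintro ⟨⟨⟨L, hL⟩, ⟨M, hM⟩⟩, φ⟩ ⟨⟨⟨L', hL'⟩, ⟨M', hM'⟩⟩, φ'⟩ heq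
      have heq' : subgroupOf (π ^ latticeConductor π M) L M (h.latticeConductor_spec hM) φ =
          subgroupOf (π ^ latticeConductor π M') L' M' (h.latticeConductor_spec hM') φ' :=
        congrArg Subtype.val heq
      obtain ⟨rfl, rfl, hφ⟩ := subgroupOf_injective (k := fun M => π ^ latticeConductor π M) hne
        heq'
      obtain rfl := eq_of_heq hφ
      rfl
    · rintro ⟨N, hN, hN'⟩
      obtain ⟨M, hM, hx, hy, hex⟩ := exists_eq_subgroupOf hN hN'
      obtain ⟨L, hL, φ, hφ⟩ := hex (π ^ latticeConductor π M) (h.latticeConductor_spec hM)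
        fun A hA => ⟨pow_latticeConductor_dvd h (hx A hA), pow_latticeConductor_dvd h (hy A hA)⟩
      exact ⟨⟨(⟨L, hL⟩, ⟨M, hM⟩), φ⟩, Subtype.ext hφ.symm⟩
  rw [← (Equiv.ofBijective f hf).hasSum_iff]
  set g : {L : AddSubgroup (R × R) // L.index ≠ 0} × {M : AddSubgroup R // M.index ≠ 0} → ℂ :=
    fun q => ((q.1.1.index * (p ^ latticeConductor π q.2.1) ^ 2 * q.2.1.index : ℕ) : ℂ) ^ (-s)
    with hg
  have hval : ((fun N : {N : Subgroup (heisenbergGroup R) // N.Normal ∧ N.index ≠ 0} =>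
      (N.1.index : ℂ) ^ (-s)) ∘ Equiv.ofBijective f hf) = fun a => g a.1 := by
    funext a
    change ((f a).1.index : ℂ) ^ (-s) = _
    rw [hindex]
  rw [hval]
  apply hasSum_sigma_of_finite
  convert hasSum_mul_prod hA hB using 1
  funext q
  rw [(hcard q).2]
  simp only [hg]
  rw [Nat.cast_mul, Complex.natCast_mul_natCast_cpow, Nat.cast_mul,
    Complex.natCast_mul_natCast_cpow, ← pow_mul, natCast_pow_cpow, mul_comm _ 2, pow_mul]
  push_cast
  ring

end Sum

/-! ### Openness of finite-index normal subgroups. -/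

section Topology

variable {R : Type*} [CommRing R] [IsDomain R] [IsDiscreteValuationRing R] [CharZero R]
  [TopologicalSpace R]

theorem isOpen_of_index_ne_zero (hadic : IsAdic (IsLocalRing.maximalIdeal R))
    {N : Subgroup (heisenbergGroup R)} (hN : N.Normal) (hN' : N.index ≠ 0) :
    IsOpen (N : Set (heisenbergGroup R)) := by
  have hring : IsTopologicalRing R := by
    rw [hadic]
    exact (RingSubgroupsBasis.toRingFilterBasis _).isTopologicalRing
  have h0 : (N.index : R) ≠ 0 := by exact_mod_cast hN'
  have hnhds : {r : R | (N.index : R) ∣ r} ∈ nhds (0 : R) := by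
    obtain ⟨π, hπ⟩ := IsDiscreteValuationRing.exists_irreducible R
    obtain ⟨j, hj⟩ := IsDiscreteValuationRing.associated_pow_irreducible h0 hπ
    rw [hadic.hasBasis_nhds_zero.mem_iff]
    refine ⟨j, trivial, fun r hr => ?_⟩
    rw [SetLike.mem_coe, hπ.maximalIdeal_eq, Ideal.span_singleton_pow,
      Ideal.mem_span_singleton] at hr
    exact hj.dvd.trans hr
  have hcont : ∀ i j, Continuous fun A : heisenbergGroup R =>
      (A : Matrix.SpecialLinearGroup (Fin 3) R).1 i j := fun i j =>
    (continuous_apply j).comp (Matrix.SpecialLinearGroup.continuous_apply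
      (fun A : heisenbergGroup R => (A : Matrix.SpecialLinearGroup (Fin 3) R))
      continuous_subtype_val i)
  apply Subgroup.isOpen_of_mem_nhds (g := 1)
  have hx : x ⁻¹' {r : R | (N.index : R) ∣ r} ∈ nhds (1 : heisenbergGroup R) :=
    (hcont 0 1).continuousAt.preimage_mem_nhds (by convert hnhds; exact x_one)
  have hy : y ⁻¹' {r : R | (N.index : R) ∣ r} ∈ nhds (1 : heisenbergGroup R) :=
    (hcont 1 2).continuousAt.preimage_mem_nhds (by convert hnhds; exact y_one)
  have hz : z ⁻¹' {r : R | (N.index : R) ∣ r} ∈ nhds (1 : heisenbergGroup R) :=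
    (hcont 0 2).continuousAt.preimage_mem_nhds (by convert hnhds; exact z_one)
  filter_upwards [hx, hy, hz] with A hAx hAy hAz
  exact mem_of_dvd hN hAx hAy hAz

end Topology

end heisenbergGroup

/-! ### The abelian factor `ℤ_[p] ^ d`. -/

section PadicTopology

variable {p : ℕ} [Fact p.Prime]

theorem PadicInt.dvd_of_norm_lt {m x : ℤ_[p]} (h : ‖x‖ < ‖m‖) : m ∣ x := by
  have hm : m ≠ 0 := by
    rintro rfl
    rw [norm_zero] at h
    exact absurd h (norm_nonneg x).not_gt
  have hm' : (m : ℚ_[p]) ≠ 0 := by simpa using hm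
  refine ⟨⟨x / m, ?_⟩, ?_⟩
  · rw [norm_div, ← PadicInt.norm_def, ← PadicInt.norm_def]
    exact div_le_one_of_le₀ h.le (norm_nonneg _)
  · apply Subtype.ext
    change (x : ℚ_[p]) = m * (x / m)
    field_simp

theorem isOpen_of_index_ne_zero_pi {d : ℕ} {N : Subgroup (Multiplicative (Fin d → ℤ_[p]))}
    (hN : N.index ≠ 0) : IsOpen (N : Set (Multiplicative (Fin d → ℤ_[p]))) := by
  apply Subgroup.isOpen_of_mem_nhds (g := 1)
  have h0 : (N.index : ℤ_[p]) ≠ 0 := by exact_mod_cast hN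
  have h1 : Metric.ball (0 : Fin d → ℤ_[p]) ‖(N.index : ℤ_[p])‖ ∈ nhds (0 : Fin d → ℤ_[p]) :=
    Metric.ball_mem_nhds _ (norm_pos_iff.2 h0)
  have h2 : ∀ v ∈ Metric.ball (0 : Fin d → ℤ_[p]) ‖(N.index : ℤ_[p])‖,
      Multiplicative.ofAdd v ∈ N := by
    intro v hv
    rw [mem_ball_zero_iff, pi_norm_lt_iff (norm_pos_iff.2 h0)] at hv
    choose w hw using fun i => PadicInt.dvd_of_norm_lt (hv i)
    have : v = N.index • w := by
      funext i
      rw [hw, Pi.smul_apply, nsmul_eq_mul]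
    rw [this, ofAdd_nsmul]
    exact N.pow_index_mem _
  exact Filter.mem_of_superset h1 h2

/-- The additive subgroups of finite index of `V` as the normal subgroups of finite index of
`Multiplicative V`. -/
def normalSubgroupEquiv (V : Type*) [AddCommGroup V] :
    {N : Subgroup (Multiplicative V) // N.Normal ∧ N.index ≠ 0} ≃
      {L : AddSubgroup V // L.index ≠ 0} :=
  (AddSubgroup.toSubgroup.toEquiv.subtypeEquiv fun L => by
    constructor
    · exact fun h => ⟨inferInstance, h⟩
    · exact fun h => h.2).symm

theorem index_normalSubgroupEquiv {V : Type*} [AddCommGroup V]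
    (N : {N : Subgroup (Multiplicative V) // N.Normal ∧ N.index ≠ 0}) :
    (normalSubgroupEquiv V N).1.index = N.1.index := rfl

theorem hasSum_index_normal_pi {d : ℕ} {V : Type*} [AddCommGroup V]
    (e : V ≃+ (Fin d → ℤ_[p])) {s : ℂ} (hs : (d : ℝ) - 1 < s.re) :
    HasSum (fun L : {L : AddSubgroup V // L.index ≠ 0} => (L.1.index : ℂ) ^ (-s))
        (normalZeta (Multiplicative (Fin d → ℤ_[p])) s) ∧
      LSeriesSummable (normalCount (Multiplicative (Fin d → ℤ_[p]))) s := by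
  obtain ⟨a, ha⟩ := summable_index_pi (p := p) d hs
  have h1 : HasSum (fun L : {L : AddSubgroup V // L.index ≠ 0} => (L.1.index : ℂ) ^ (-s)) a := by
    rw [← e.finiteIndexEquiv.hasSum_iff] at ha
    convert ha using 1
    funext L
    rw [Function.comp_apply, e.index_finiteIndexEquiv]
  have h3 : HasSum (fun N : {N : Subgroup (Multiplicative (Fin d → ℤ_[p])) //
      N.Normal ∧ N.index ≠ 0} => (N.1.index : ℂ) ^ (-s)) a := by
    rw [← (normalSubgroupEquiv (Fin d → ℤ_[p])).hasSum_iff] at ha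
    convert ha using 1
    funext N
    rw [Function.comp_apply, index_normalSubgroupEquiv]
  have h2 := (LSeriesHasSum_normalCount
    (fun N _ hN => isOpen_of_index_ne_zero_pi (p := p) (d := d) hN) h3).2
  refine ⟨?_, h2.LSeriesSummable⟩
  rw [normalZeta, h2.LSeries_eq]
  exact h1

end PadicTopology

/-! ### Exponents of `p` and the domain of convergence. -/

section NumericalData

variable {p : ℕ} [Fact p.Prime]

theorem prime_cpow_natCast_add_mul (A B : ℕ) (s : ℂ) :
    (p : ℂ) ^ ((A : ℂ) + B * -s) = (p : ℂ) ^ A * ((p : ℂ) ^ (-s)) ^ B := by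
  have hp : (p : ℂ) ≠ 0 := by exact_mod_cast (Fact.out : p.Prime).ne_zero
  rw [Complex.cpow_add _ _ hp, Complex.cpow_natCast, Complex.cpow_nat_mul]

theorem numericalData_eq {N k : ℕ} (hk : k < N) (s : ℂ) :
    numericalData p (N + 1) s (k + 1) =
      ((p : ℂ) ^ (2 * (N + 1)) * (p : ℂ) ^ (-s)) ^ (N - k) * (((p : ℂ) ^ (-s)) ^ 2) ^ (N + 1) *
        (p : ℂ) ^ ((k + 1) * (N - k)) := by
  obtain ⟨m, rfl⟩ := Nat.exists_eq_add_of_lt hk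
  have hsub : k + m + 1 - k = m + 1 := by omega
  have hz : (2 * ((k + m + 1 + 1 : ℕ) : ℂ) + (k + 1 : ℕ)) * ((k + m + 1 + 1 : ℕ) - (k + 1 : ℕ)) -
      (3 * ((k + m + 1 + 1 : ℕ) : ℂ) - (k + 1 : ℕ)) * s =
        (((2 * (k + m + 2) + (k + 1)) * (m + 1) : ℕ) : ℂ) +
          ((m + 1 + 2 * (k + m + 2) : ℕ) : ℂ) * -s := by
    push_cast
    ring
  rw [numericalData, hz, prime_cpow_natCast_add_mul, hsub]
  ring

theorem norm_numericalData_lt_one {N k : ℕ} (hk : k < N) {s : ℂ}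
    (hs : 2 * ((N + 1 : ℕ) : ℝ) - 1 < s.re) : ‖numericalData p (N + 1) s (k + 1)‖ < 1 := by
  -- Writing `N = k + m + 1` removes all subtractions and leaves a polynomial inequality in
  -- nonnegative `k` and `m`.
  obtain ⟨m, rfl⟩ := Nat.exists_eq_add_of_lt hk
  apply norm_prime_cpow_lt_one
  have hre : ((2 * ((k + m + 1 + 1 : ℕ) : ℂ) + (k + 1 : ℕ)) *
      ((k + m + 1 + 1 : ℕ) - (k + 1 : ℕ)) -
      (3 * ((k + m + 1 + 1 : ℕ) : ℂ) - (k + 1 : ℕ)) * s).re =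
        (3 * k + 2 * m + 5) * (m + 1) - (3 * m + 2 * k + 5) * s.re := by
    have hz : (2 * ((k + m + 1 + 1 : ℕ) : ℂ) + (k + 1 : ℕ)) *
        ((k + m + 1 + 1 : ℕ) - (k + 1 : ℕ)) -
        (3 * ((k + m + 1 + 1 : ℕ) : ℂ) - (k + 1 : ℕ)) * s =
          (((3 * k + 2 * m + 5) * (m + 1) : ℝ) : ℂ) - ((3 * m + 2 * k + 5 : ℝ) : ℂ) * s := by
      push_cast
      ring
    rw [hz, Complex.sub_re, Complex.ofReal_re, Complex.re_ofReal_mul]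
  rw [hre, sub_neg]
  push_cast at hs
  have hk0 : (0 : ℝ) ≤ k := k.cast_nonneg
  have hm0 : (0 : ℝ) ≤ m := m.cast_nonneg
  have h1 : (3 * m + 2 * k + 5 : ℝ) * (2 * (k + m + 1 + 1) - 1) < (3 * m + 2 * k + 5) * s.re :=
    mul_lt_mul_of_pos_left hs (by positivity)
  nlinarith [mul_nonneg hk0 hm0, mul_nonneg hk0 hk0, mul_nonneg hm0 hm0]

theorem prime_cpow_eq_inv_pow_mul (a b : ℕ) (s : ℂ) :
    (p : ℂ) ^ (-(a : ℂ) + 2 * (b : ℂ) * s) =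
      (p : ℂ)⁻¹ ^ a * (((p : ℂ) ^ (-s)) ^ 2)⁻¹ ^ b := by
  have hp : (p : ℂ) ≠ 0 := by exact_mod_cast (Fact.out : p.Prime).ne_zero
  have h2 : 2 * (b : ℂ) * s = -(((2 * b : ℕ) : ℂ) * -s) := by
    push_cast
    ring
  rw [Complex.cpow_add _ _ hp, h2, Complex.cpow_neg, Complex.cpow_neg, Complex.cpow_natCast,
    Complex.cpow_nat_mul, inv_pow, inv_pow, ← pow_mul]

end NumericalData

/-! ### Assembly of the formula. -/

/-- Characteristic zero makes the structure map injective, since a nonzero `p`-adic integer is a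
unit times a power of `p`; then `R` is torsion-free and finite over a principal ideal domain. -/
theorem Module.free_padicInt_of_finite (p : ℕ) [Fact p.Prime] (R : Type*) [CommRing R] [IsDomain R]
    [CharZero R] [Algebra ℤ_[p] R] [Module.Finite ℤ_[p] R] : Module.Free ℤ_[p] R := by
  have hinj : Function.Injective (algebraMap ℤ_[p] R) := by
    rw [injective_iff_map_eq_zero]
    intro a ha
    by_contra h0
    have hu := PadicInt.unitCoeff_spec h0
    rw [hu, map_mul, map_pow, map_natCast] at ha
    rcases mul_eq_zero.1 ha with h | h
    · exact ((PadicInt.unitCoeff h0).isUnit.map (algebraMap ℤ_[p] R)).ne_zero h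
    · exact pow_ne_zero _ (Nat.cast_ne_zero.2 (Fact.out : p.Prime).ne_zero) h
  have : FaithfulSMul ℤ_[p] R := (faithfulSMul_iff_algebraMap_injective _ _).2 hinj
  have : Module.IsTorsionFree ℤ_[p] R := inferInstance
  exact Module.free_of_finite_type_torsion_free'

theorem heisenbergGroup.hasSum_index_normal_formula {p : ℕ} [Fact p.Prime] {N : ℕ}
    {R : Type*} [CommRing R] [IsDomain R] [IsDiscreteValuationRing R] [CharZero R]
    [Algebra ℤ_[p] R] [Module.Finite ℤ_[p] R] [Module.Free ℤ_[p] R] {π : R}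
    (h : IsTotallyRamifiedAt p (N + 1) π) (hdeg : Module.finrank ℤ_[p] R = N + 1) {s : ℂ}
    (hs : 2 * ((N + 1 : ℕ) : ℝ) - 1 < s.re) :
    LSeriesSummable (normalCount (Multiplicative (Fin (2 * (N + 1)) → ℤ_[p]))) s ∧
    HasSum (fun N : {N : Subgroup (heisenbergGroup R) // N.Normal ∧ N.index ≠ 0} =>
        (N.1.index : ℂ) ^ (-s))
      (normalZeta (Multiplicative (Fin (2 * (N + 1)) → ℤ_[p])) s *
        ((∑ w : Equiv.Perm (Fin (N + 1 - 1)),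
            (p : ℂ) ^ (-(coxeterLength w : ℂ) +
              2 * (parabolicLength (Finset.Icc 1 (N + 1 - 3)) w : ℂ) * s) *
            ∏ j ∈ descentSet w, numericalData p (N + 1) s (j + 1)) /
          ((1 - (p : ℂ) ^ (2 * ((N + 1 : ℕ) : ℂ) - 3 * s)) *
            ∏ i ∈ Finset.Icc 1 (N + 1 - 1), (1 - numericalData p (N + 1) s i)))) := by
  have hp : (p : ℂ) ≠ 0 := by exact_mod_cast h.prime.ne_zero
  have hq : (p : ℂ) ^ (-s) ≠ 0 := by simp [Complex.cpow_eq_zero_iff, hp]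
  have hXY : (p : ℂ) ^ (2 * (N + 1)) * (p : ℂ) ^ (-s) * ((p : ℂ) ^ (-s)) ^ 2 =
      (p : ℂ) ^ (2 * ((N + 1 : ℕ) : ℂ) - 3 * s) := by
    have : 2 * ((N + 1 : ℕ) : ℂ) - 3 * s = ((2 * (N + 1) : ℕ) : ℂ) + ((3 : ℕ) : ℂ) * -s := by
      push_cast
      ring
    rw [this, prime_cpow_natCast_add_mul]
    ring
  have hXYlt : ‖(p : ℂ) ^ (2 * ((N + 1 : ℕ) : ℂ) - 3 * s)‖ < 1 := by
    apply norm_prime_cpow_lt_one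
    have : (2 * ((N + 1 : ℕ) : ℂ) - 3 * s).re = 2 * ((N + 1 : ℕ) : ℝ) - 3 * s.re := by simp
    rw [this]
    push_cast at hs ⊢
    linarith [(Nat.cast_nonneg N : (0 : ℝ) ≤ N)]
  -- The factor `p ^ (2n)` in `X` counts homomorphisms into `R / M`; `Y = p ^ (-2s)` is the cost of
  -- scaling both coordinates by `π`.
  have hB := h.hasSum_lattice (pow_ne_zero 2 hq)
    (X := (p : ℂ) ^ (2 * (N + 1)) * (p : ℂ) ^ (-s))
    (φ := fun m => (m : ℂ) ^ (2 * (N + 1)) * (m : ℂ) ^ (-s))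
    (fun k => by rw [natCast_pow_cpow, mul_pow, Nat.cast_pow, pow_right_comm])
    (fun k => numericalData p (N + 1) s (k + 1)) (fun k => numericalData_eq k.2 s)
    (fun k => norm_numericalData_lt_one k.2 hs) (by rwa [hXY])
  have hfin : Module.finrank ℤ_[p] (R × R) = 2 * (N + 1) := by
    rw [Module.finrank_prod, hdeg, two_mul]
  obtain ⟨hA, hsum⟩ := hasSum_index_normal_pi
    (Module.finBasisOfFinrankEq ℤ_[p] (R × R) hfin).equivFun.toAddEquiv (s := s)
    (by push_cast at hs ⊢; exact hs)
  refine ⟨hsum, ?_⟩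
  convert heisenbergGroup.hasSum_index_normal h hdeg hA hB using 2
  rw [hXY, div_eq_mul_inv, mul_inv, ← Finset.prod_inv_distrib, mul_left_comm]
  congr 2
  · exact Finset.sum_congr rfl fun w _ => by rw [prime_cpow_eq_inv_pow_mul]
  · rw [Fin.prod_univ_eq_prod_range fun k => (1 - numericalData p (N + 1) s (k + 1))⁻¹,
      Finset.range_eq_Ico, Finset.prod_Ico_add' fun k => (1 - numericalData p (N + 1) s k)⁻¹]
    rfl

theorem mainTheorem4 (p : ℕ) [Fact p.Prime] (n : ℕ)
    (R : Type*) [CommRing R] [IsDomain R] [IsDiscreteValuationRing R] [CharZero R]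
    [Algebra ℤ_[p] R] [Module.Finite ℤ_[p] R]
    [TopologicalSpace R] (hadic : IsAdic (IsLocalRing.maximalIdeal R))
    (hdeg : Module.finrank ℤ_[p] R = n)
    (hram : (IsLocalRing.maximalIdeal R).inertiaDeg ℤ_[p] = 1) :
    (∀ m : ℕ, 0 < m → (openNormalSubgroups (heisenbergGroup R) m).Finite) ∧
    ∀ s : ℂ, 2 * (n : ℝ) - 1 < s.re →
      LSeriesSummable (normalCount (heisenbergGroup R)) s ∧
      LSeriesSummable (normalCount (Multiplicative (Fin (2 * n) → ℤ_[p]))) s ∧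
      normalZeta (heisenbergGroup R) s =
        normalZeta (Multiplicative (Fin (2 * n) → ℤ_[p])) s *
          ((∑ w : Equiv.Perm (Fin (n - 1)),
              (p : ℂ) ^ (-(coxeterLength w : ℂ) +
                2 * (parabolicLength (Finset.Icc 1 (n - 3)) w : ℂ) * s) *
              ∏ j ∈ descentSet w, numericalData p n s (j + 1)) /
            ((1 - (p : ℂ) ^ (2 * (n : ℂ) - 3 * s)) *
              ∏ i ∈ Finset.Icc 1 (n - 1), (1 - numericalData p n s i))) := by
  have hfree : Module.Free ℤ_[p] R := Module.free_padicInt_of_finite p R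
  have hn : n ≠ 0 := by
    rw [← hdeg]
    exact Module.finrank_pos.ne'
  obtain ⟨N, rfl⟩ := Nat.exists_eq_succ_of_ne_zero hn
  obtain ⟨π, hπ⟩ := IsDiscreteValuationRing.exists_irreducible R
  have h := isTotallyRamifiedAt_of_inertiaDeg_eq_one hdeg hram hπ
  have key := fun (s : ℂ) (hs : 2 * ((N + 1 : ℕ) : ℝ) - 1 < s.re) =>
    heisenbergGroup.hasSum_index_normal_formula h hdeg hs
  have hL := fun s hs => LSeriesHasSum_normalCount
    (fun M hM hM' => heisenbergGroup.isOpen_of_index_ne_zero hadic hM hM') (key s hs).2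
  -- Finiteness of the counts needs just one point of convergence, and `s = 2n` serves.
  refine ⟨(hL (2 * ((N + 1 : ℕ) : ℝ) : ℝ) (by rw [Complex.ofReal_re]; linarith)).1,
    fun s hs => ⟨(hL s hs).2.LSeriesSummable, (key s hs).1, (hL s hs).2.LSeries_eq⟩⟩
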